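/- Let $\mathbb{K}$ be an extension field of $\mathbb{C}$ with an involutive field automorphism $\lambda\mapsto\lambda^*$ extending complex conjugation, and let $q\in\mathbb{K}^\times$ be an element which is not a root of unity and which has a fixed square root $q^{1/2}$ with $(q^{1/2})^*=q^{1/2}$. Let $U_q(\mathfrak{u})$ be the Drinfeld–Jimbo algebra $U_q(\mathfrak{sl}_2)$, generated by $E,F,k^{\pm1}$ with $kk^{-1}=k^{-1}k=1$, $kEk^{-1}=q^2E$, $kFk^{-1}=q^{-2}F$, $EF-FE=\frac{k-k^{-1}}{q-q^{-1}}$, with coproduct $\Delta(E)=E\otimes1+k\otimes E$, $\Delta(F)=F\otimes k^{-1}+1\otimes F$, $\Delta(k)=k\otimes k$. Let $\mathcal{O}_q(U)$, $U=\mathrm{SU}(2)$, be the Hopf algebra generated by the entries of a $2\times2$ matrix $u$ subject to $u^*u=uu^*=1$, where $u^*=\mathrm{diag}(1,q)\,\mathrm{adj}(u)\,\mathrm{diag}(1,q^{-1})$ and $\mathrm{adj}(u)=\begin{pmatrix}u_{22}&-u_{12}\\-u_{21}&u_{11}\end{pmatrix}$, with $\Delta(u_{\alpha\beta})=\sum_\gamma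 u_{\alpha\gamma}\otimes u_{\gamma\beta}$ and $\epsilon(u)=1$. They are in Hopf duality through the pairing determined by $$\langle u,E\rangle=\begin{pmatrix}0&q^{1/2}\\0&0\end{pmatrix},\quad \langle u,F\rangle=\begin{pmatrix}0&0\\q^{-1/2}&0\end{pmatrix},\quad \langle u,k\rangle=\begin{pmatrix}q&0\\0&q^{-1}\end{pmatrix}.$$ Write $y\triangleleft x=\langle x,y_{(1)}\rangle y_{(2)}$ for $x\in U_q(\mathfrak{u})$, $y\in\mathcal{O}_q(U)$. Put $\theta=iq^{-1/2}(E-Fk)$, let $U_q(\mathfrak{k})$ be the unital subalgebra of $U_q(\mathfrak{u})$ generated by $\theta$, and let $\mathcal{O}_q(K\backslash U)=\{y\in\mathcal{O}_q(U): y\triangleleft\theta=0\}$, a unital subalgebra of $\mathcal{O}_q(U)$. Let $U_q(\mathfrak{g})$, $\mathfrak{g}=\mathfrak{sl}(2,\mathbb{R})$, be the subalgebra generated by $U_q(\mathfrak{k})$ and $\mathcal{O}_q(K\backslash U)$ in the Drinfeld double of the skew-pairing $(x,y)\mapsto\langle y,x\rangle$ on $U_q(\mathfrak{u})^{\mathrm{cop}}\times\mathcal{O}_q(U)$,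 where $\mathrm{cop}$ denotes the opposite coproduct. Explicitly, this double is $\mathcal{O}_q(U)\otimes U_q(\mathfrak{u})$ with the product $$(b\otimes a)(b'\otimes a')=\langle S^{-1}(a_{(3)}),b'_{(1)}\rangle\,\langle a_{(1)},b'_{(3)}\rangle\; b\,b'_{(2)}\otimes a_{(2)}a',$$ $S$ being the antipode of $U_q(\mathfrak{u})$. Define $X,Y,Z\in\mathcal{O}_q(K\backslash U)$ by $$u^*\begin{pmatrix}0&-1\\1&0\end{pmatrix}u=\begin{pmatrix}iq^{-1}Z&-Y\\X&-iqZ\end{pmatrix},$$ and for $n\in\mathbb{Z}$ put $W^{(n)}=Y^n$ if $n\ge0$ and $W^{(n)}=X^{-n}$ if $n<0$. Here a filtration of a unital algebra $A$ is an increasing sequence of linear subspaces $(A^{(r)})_{r\ge0}$ with $1\in A^{(0)}$, $A^{(r)}A^{(s)}\subset A^{(r+s)}$ for all $r,s$, and $\bigcup_rA^{(r)}=A$. Then: 1. The family $(W^{(n)}Z^m)_{n\in\mathbb{Z},\,m\ge0}$ is a basis of $\mathcal{O}_q(K\backslash U)$. 2. The subspaces $\mathcal{O}_q(K\backslash U)^{(r)}=\mathrm{span}(W^{(n)}Z^m: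 n\in\mathbb{Z},\ m\ge0,\ |n|+m\le r)$, $r\ge0$, form a filtration of the algebra $\mathcal{O}_q(K\backslash U)$. 3. The family $(\theta^{m_1}W^{(n)}Z^{m_2})_{m_1,m_2\ge0,\,n\in\mathbb{Z}}$ is a basis of $U_q(\mathfrak{g})$. 4. The subspaces $U_q(\mathfrak{g})^{(r)}=\sum_{0\le n\le r}\theta^n\,\mathcal{O}_q(K\backslash U)^{(r-n)}$, $r\ge0$, form a filtration of the algebra $U_q(\mathfrak{g})$. -/

import Mathlib

open scoped TensorProduct

noncomputable section

namespace QuantumSL2R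

/-! ### The deformation parameter -/

/-- A deformation parameter: `K` is a field with involution `star`, and `sqrt` is a fixed
self-adjoint square root of an element `q = sqrt ^ 2` of `K` that is nonzero
and not a root of unity. -/
structure Param (K : Type*) [Field K] [StarRing K] where
  sqrt : K
  star_sqrt : star sqrt = sqrt
  sqrt_ne_zero : sqrt ≠ 0
  not_root_of_unity : ∀ n : ℕ, 0 < n → (sqrt ^ 2) ^ n ≠ 1

section

set_option linter.unusedSectionVars false

variable {K : Type*} [Field K] [StarRing K]

/-- The parameter `q`. -/
def Param.q (p : Param K) : K := p.sqrt ^ 2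

lemma Param.q_def (p : Param K) : p.q = p.sqrt ^ 2 := rfl

lemma Param.q_ne_zero (p : Param K) : p.q ≠ 0 := pow_ne_zero 2 p.sqrt_ne_zero

lemma Param.q_sub_ne_zero (p : Param K) : p.q - p.q⁻¹ ≠ 0 := by
  intro h
  apply p.not_root_of_unity 2 (by norm_num)
  have h0 := p.q_ne_zero
  rw [← Param.q_def]
  field_simp at h
  linear_combination h

/-! ### The Drinfeld–Jimbo algebra `U_q(sl₂)` -/

/-- The generators `E`, `F`, `k`, `k⁻¹`. -/
inductive UGen
  | E | F | k | kInv

/-- The defining relations of `U_q(sl₂)`. -/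
inductive URel (p : Param K) : FreeAlgebra K UGen → FreeAlgebra K UGen → Prop
  | k_kInv : URel p (FreeAlgebra.ι K .k * FreeAlgebra.ι K .kInv) 1
  | kInv_k : URel p (FreeAlgebra.ι K .kInv * FreeAlgebra.ι K .k) 1
  | k_E : URel p (FreeAlgebra.ι K .k * FreeAlgebra.ι K .E * FreeAlgebra.ι K .kInv)
      (p.q ^ 2 • FreeAlgebra.ι K .E)
  | k_F : URel p (FreeAlgebra.ι K .k * FreeAlgebra.ι K .F * FreeAlgebra.ι K .kInv)
      ((p.q ^ 2)⁻¹ • FreeAlgebra.ι K .F)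
  | E_F : URel p
      (FreeAlgebra.ι K .E * FreeAlgebra.ι K .F - FreeAlgebra.ι K .F * FreeAlgebra.ι K .E)
      ((p.q - p.q⁻¹)⁻¹ • (FreeAlgebra.ι K .k - FreeAlgebra.ι K .kInv))

/-- `U_q(sl₂)`, the underlying algebra of `U_q(𝔲)`. -/
def Uq (p : Param K) : Type _ := RingQuot (URel p)

namespace Uq

variable (p : Param K)

instance : Ring (Uq p) := inferInstanceAs (Ring (RingQuot (URel p)))
instance : Algebra K (Uq p) := inferInstanceAs (Algebra K (RingQuot (URel p)))

/-- The quotient map. -/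
def mk : FreeAlgebra K UGen →ₐ[K] Uq p := RingQuot.mkAlgHom K (URel p)

lemma mk_rel {x y : FreeAlgebra K UGen} (h : URel p x y) : mk p x = mk p y :=
  RingQuot.mkAlgHom_rel K h

/-- The class of a generator. -/
def gen (g : UGen) : Uq p := mk p (FreeAlgebra.ι K g)

abbrev E : Uq p := gen p .E
abbrev F : Uq p := gen p .F
abbrev k : Uq p := gen p .k
abbrev kInv : Uq p := gen p .kInv

lemma k_mul_kInv : k p * kInv p = 1 := by
  simpa [gen] using mk_rel p .k_kInv

lemma kInv_mul_k : kInv p * k p = 1 := by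
  simpa [gen] using mk_rel p .kInv_k

lemma k_mul_E : k p * E p * kInv p = p.q ^ 2 • E p := by
  simpa [gen] using mk_rel p .k_E

lemma k_mul_F : k p * F p * kInv p = (p.q ^ 2)⁻¹ • F p := by
  simpa [gen] using mk_rel p .k_F

lemma E_mul_F : E p * F p - F p * E p = (p.q - p.q⁻¹)⁻¹ • (k p - kInv p) := by
  simpa [gen] using mk_rel p .E_F

variable {p}

/-- The universal property of `U_q(sl₂)`. -/
def lift {A : Type*} [Ring A] [Algebra K A] (e f c d : A) (h1 : c * d = 1) (h2 : d * c = 1)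
    (h3 : c * e * d = p.q ^ 2 • e) (h4 : c * f * d = (p.q ^ 2)⁻¹ • f)
    (h5 : e * f - f * e = (p.q - p.q⁻¹)⁻¹ • (c - d)) : Uq p →ₐ[K] A :=
  RingQuot.liftAlgHom K
    ⟨FreeAlgebra.lift K (fun g => match g with | .E => e | .F => f | .k => c | .kInv => d), by
      intro x y h
      cases h <;> simp [h1, h2, h3, h4, h5]⟩

lemma lift_gen {A : Type*} [Ring A] [Algebra K A] {e f c d : A} (h1 : c * d = 1) (h2 : d * c = 1)
    (h3 : c * e * d = p.q ^ 2 • e) (h4 : c * f * d = (p.q ^ 2)⁻¹ • f)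
    (h5 : e * f - f * e = (p.q - p.q⁻¹)⁻¹ • (c - d)) (g : UGen) :
    lift e f c d h1 h2 h3 h4 h5 (gen p g) =
      (match g with | .E => e | .F => f | .k => c | .kInv => d) :=
  (RingQuot.liftAlgHom_mkAlgHom_apply K _ _ _).trans (by rw [FreeAlgebra.lift_ι_apply])

section

variable {A : Type*} [Ring A] [Algebra K A] {e f c d : A} (h1 : c * d = 1) (h2 : d * c = 1)
    (h3 : c * e * d = p.q ^ 2 • e) (h4 : c * f * d = (p.q ^ 2)⁻¹ • f)
    (h5 : e * f - f * e = (p.q - p.q⁻¹)⁻¹ • (c - d))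

@[simp] lemma lift_E : lift e f c d h1 h2 h3 h4 h5 (E p) = e := lift_gen ..
@[simp] lemma lift_F : lift e f c d h1 h2 h3 h4 h5 (F p) = f := lift_gen ..
@[simp] lemma lift_k : lift e f c d h1 h2 h3 h4 h5 (k p) = c := lift_gen ..
@[simp] lemma lift_kInv : lift e f c d h1 h2 h3 h4 h5 (kInv p) = d := lift_gen ..

end

lemma algHom_ext {A : Type*} [Semiring A] [Algebra K A] {φ ψ : Uq p →ₐ[K] A}
    (hE : φ (E p) = ψ (E p)) (hF : φ (F p) = ψ (F p)) (hk : φ (k p) = ψ (k p))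
    (hkInv : φ (kInv p) = ψ (kInv p)) : φ = ψ := by
  apply RingQuot.ringQuot_ext'
  apply FreeAlgebra.hom_ext
  funext g
  cases g
  exacts [hE, hF, hk, hkInv]

/-- Induction on elements of `U_q(sl₂)`. -/
lemma induction {P : Uq p → Prop} (x : Uq p) (hE : P (E p)) (hF : P (F p)) (hk : P (k p))
    (hkInv : P (kInv p)) (hc : ∀ c : K, P (algebraMap K _ c))
    (hadd : ∀ x y, P x → P y → P (x + y)) (hmul : ∀ x y, P x → P y → P (x * y)) : P x := by
  obtain ⟨y, rfl⟩ := RingQuot.mkAlgHom_surjective K (URel p) x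
  induction y using FreeAlgebra.induction with
  | grade0 r => rw [AlgHom.commutes]; exact hc r
  | grade1 g => cases g; exacts [hE, hF, hk, hkInv]
  | mul a b ha hb => rw [map_mul]; exact hmul _ _ ha hb
  | add a b ha hb => rw [map_add]; exact hadd _ _ ha hb

lemma k_E : k p * E p = p.q ^ 2 • (E p * k p) := by
  have h := congrArg (· * k p) (k_mul_E p)
  simpa [mul_assoc, kInv_mul_k] using h

lemma k_F : k p * F p = (p.q ^ 2)⁻¹ • (F p * k p) := by
  have h := congrArg (· * k p) (k_mul_F p)
  simpa [mul_assoc, kInv_mul_k] using h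

lemma E_kInv : E p * kInv p = p.q ^ 2 • (kInv p * E p) := by
  have h := congrArg (kInv p * ·) (k_mul_E p)
  simpa [← mul_assoc, kInv_mul_k] using h

lemma F_kInv : F p * kInv p = (p.q ^ 2)⁻¹ • (kInv p * F p) := by
  have h := congrArg (kInv p * ·) (k_mul_F p)
  simpa [← mul_assoc, kInv_mul_k] using h

variable (p)

/-- The coproduct of `U_q(sl₂)`:
`Δ(E) = E ⊗ 1 + k ⊗ E`, `Δ(F) = F ⊗ k⁻¹ + 1 ⊗ F`, `Δ(k) = k ⊗ k`. -/
def comulHom : Uq p →ₐ[K] Uq p ⊗[K] Uq p :=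
  lift (E p ⊗ₜ 1 + k p ⊗ₜ E p) (F p ⊗ₜ kInv p + 1 ⊗ₜ F p) (k p ⊗ₜ k p) (kInv p ⊗ₜ kInv p)
    (by simp [k_mul_kInv, Algebra.TensorProduct.one_def])
    (by simp [kInv_mul_k, Algebra.TensorProduct.one_def])
    (by
      simp only [mul_add, add_mul, Algebra.TensorProduct.tmul_mul_tmul, k_mul_kInv,
        mul_one, mul_assoc, smul_add]
      simp only [← mul_assoc, k_mul_E, TensorProduct.smul_tmul',
        TensorProduct.tmul_smul])
    (by
      simp only [mul_add, add_mul, Algebra.TensorProduct.tmul_mul_tmul, k_mul_kInv,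
        mul_one, mul_assoc, smul_add]
      simp only [← mul_assoc, k_mul_F, one_mul, TensorProduct.smul_tmul',
        TensorProduct.tmul_smul])
    (by
      have h0 : p.q ^ 2 ≠ 0 := pow_ne_zero 2 p.q_ne_zero
      have h1 : (k p * F p) ⊗ₜ[K] (E p * kInv p) = (F p * k p) ⊗ₜ[K] (kInv p * E p) := by
        rw [k_F, E_kInv, TensorProduct.tmul_smul, TensorProduct.smul_tmul', smul_smul,
          mul_inv_cancel₀ h0, one_smul]
      have h2 : E p * F p = F p * E p + (p.q - p.q⁻¹)⁻¹ • (k p - kInv p) := by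
        rw [← E_mul_F]; abel
      simp only [mul_add, add_mul, Algebra.TensorProduct.tmul_mul_tmul, one_mul, mul_one, h1, h2]
      simp only [TensorProduct.add_tmul, TensorProduct.tmul_add, ← TensorProduct.smul_tmul',
        TensorProduct.tmul_smul, TensorProduct.sub_tmul, TensorProduct.tmul_sub, smul_sub]
      abel)

/-- The counit of `U_q(sl₂)`. -/
def counitHom : Uq p →ₐ[K] K :=
  lift 0 0 1 1 (by simp) (by simp) (by simp) (by simp) (by simp)

instance : Bialgebra K (Uq p) :=
  Bialgebra.ofAlgHom (comulHom p) (counitHom p)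
    (by apply algHom_ext <;>
      simp [comulHom, TensorProduct.add_tmul, TensorProduct.tmul_add, add_assoc,
        Algebra.TensorProduct.one_def])
    (by apply algHom_ext <;> simp [comulHom, counitHom])
    (by apply algHom_ext <;> simp [comulHom, counitHom])

lemma comul_eq (x : Uq p) : Coalgebra.comul (R := K) x = comulHom p x := rfl

lemma counit_eq (x : Uq p) : Coalgebra.counit (R := K) x = counitHom p x := rfl

/-- The inverse of the antipode of `U_q(sl₂)`, an anti-automorphism, given on generators by
`S⁻¹(E) = -E k⁻¹`, `S⁻¹(F) = -k F`, `S⁻¹(k) = k⁻¹`. -/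
def invAntipode : Uq p →ₐ[K] (Uq p)ᵐᵒᵖ :=
  lift (MulOpposite.op (-(E p * kInv p))) (MulOpposite.op (-(k p * F p)))
    (MulOpposite.op (kInv p)) (MulOpposite.op (k p))
    (by rw [← MulOpposite.op_mul, k_mul_kInv]; rfl)
    (by rw [← MulOpposite.op_mul, kInv_mul_k]; rfl)
    (by
      simp only [← MulOpposite.op_mul, ← MulOpposite.op_smul, mul_neg, neg_mul, smul_neg]
      congr 2
      simp only [← mul_assoc, k_E, smul_mul_assoc]
      simp only [mul_assoc, k_mul_kInv, mul_one])
    (by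
      simp only [← MulOpposite.op_mul, ← MulOpposite.op_smul, mul_neg, neg_mul, smul_neg]
      congr 2
      simp only [mul_assoc, F_kInv, mul_smul_comm]
      congr 2
      simp only [← mul_assoc, k_mul_kInv, one_mul])
    (by
      have h0 : p.q ^ 2 ≠ 0 := pow_ne_zero 2 p.q_ne_zero
      simp only [← MulOpposite.op_mul, ← MulOpposite.op_smul, ← MulOpposite.op_sub, neg_mul_neg]
      congr 1
      have h1 : k p * F p * (E p * kInv p) = F p * E p := by
        rw [E_kInv, k_F, smul_mul_smul_comm, inv_mul_cancel₀ h0, one_smul]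
        rw [mul_assoc, ← mul_assoc (k p), k_mul_kInv, one_mul]
      have h2 : E p * kInv p * (k p * F p) = E p * F p := by
        rw [mul_assoc, ← mul_assoc (kInv p), kInv_mul_k, one_mul]
      rw [h1, h2, ← neg_sub, E_mul_F, ← smul_neg, neg_sub])

end Uq


/-! ### The quantized function algebra `O_q(SU(2))` -/

/-- For a `2 × 2` matrix `M` with entries in an algebra, the matrix
`diag(1, q) * adj(M) * diag(1, q⁻¹)`, where `adj(M)` is the adjugate matrix. -/
def qStar (q : K) {A : Type*} [Ring A] [Algebra K A] (M : Matrix (Fin 2) (Fin 2) A) :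
    Matrix (Fin 2) (Fin 2) A :=
  !![M 1 1, -(q⁻¹ • M 0 1); -(q • M 1 0), M 0 0]

lemma qStar_mul (q : K) {A : Type*} [Ring A] [Algebra K A] (M N : Matrix (Fin 2) (Fin 2) A)
    (h : ∀ i j k l, Commute (M i j) (N k l)) (hq : q ≠ 0) :
    qStar q (M * N) = qStar q N * qStar q M := by
  have h' : ∀ i j k l, M i j * N k l = N k l * M i j := fun i j k l => h i j k l
  ext i j
  fin_cases i <;> fin_cases j <;>
    simp [qStar, Matrix.mul_apply, Fin.sum_univ_two, h', smul_smul, hq, add_comm]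

lemma qStar_map (q : K) {A B : Type*} [Ring A] [Algebra K A] [Ring B] [Algebra K B]
    (φ : A →ₐ[K] B) (M : Matrix (Fin 2) (Fin 2) A) :
    qStar q (M.map φ) = (qStar q M).map φ := by
  ext i j
  fin_cases i <;> fin_cases j <;> simp [qStar]

/-- The matrix of free generators. -/
def freeMatrix (K : Type*) [Field K] : Matrix (Fin 2) (Fin 2) (FreeAlgebra K (Fin 2 × Fin 2)) :=
  Matrix.of fun i j => FreeAlgebra.ι K (i, j)

/-- The defining relations `u* u = u u* = 1`, where `u* = diag(1, q) * adj(u) * diag(1, q⁻¹)`. -/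
inductive ORel (p : Param K) :
    FreeAlgebra K (Fin 2 × Fin 2) → FreeAlgebra K (Fin 2 × Fin 2) → Prop
  | left (i j : Fin 2) : ORel p ((qStar p.q (freeMatrix K) * freeMatrix K) i j)
      ((1 : Matrix (Fin 2) (Fin 2) (FreeAlgebra K (Fin 2 × Fin 2))) i j)
  | right (i j : Fin 2) : ORel p ((freeMatrix K * qStar p.q (freeMatrix K)) i j)
      ((1 : Matrix (Fin 2) (Fin 2) (FreeAlgebra K (Fin 2 × Fin 2))) i j)

/-- `O_q(U)` for `U = SU(2)`. The relation `u* = diag(1, q) * adj(u) * diag(1, q⁻¹)`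
expresses the adjoints of the generators `u i j` through the generators, so that the underlying
algebra is generated by the `u i j`. -/
def Oq (p : Param K) : Type _ := RingQuot (ORel p)

namespace Oq

variable (p : Param K)

instance : Ring (Oq p) := inferInstanceAs (Ring (RingQuot (ORel p)))
instance : Algebra K (Oq p) := inferInstanceAs (Algebra K (RingQuot (ORel p)))

/-- The quotient map. -/
def mk : FreeAlgebra K (Fin 2 × Fin 2) →ₐ[K] Oq p := RingQuot.mkAlgHom K (ORel p)

/-- The generating matrix `u`. -/
def u : Matrix (Fin 2) (Fin 2) (Oq p) := (freeMatrix K).map (mk p)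

/-- The matrix `u*`. -/
def uStar : Matrix (Fin 2) (Fin 2) (Oq p) := qStar p.q (u p)

lemma uStar_mul_u : uStar p * u p = 1 := by
  rw [uStar, u, qStar_map, ← Matrix.map_mul]
  ext i j
  rw [Matrix.map_apply, show mk p _ = mk p _ from RingQuot.mkAlgHom_rel K (ORel.left i j),
    ← Matrix.map_apply (f := mk p), Matrix.map_one _ (map_zero _) (map_one _)]

lemma u_mul_uStar : u p * uStar p = 1 := by
  rw [uStar, u, qStar_map, ← Matrix.map_mul]
  ext i j
  rw [Matrix.map_apply, show mk p _ = mk p _ from RingQuot.mkAlgHom_rel K (ORel.right i j),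
    ← Matrix.map_apply (f := mk p), Matrix.map_one _ (map_zero _) (map_one _)]

variable {p}

/-- The universal property of `O_q(U)`. -/
def lift {A : Type*} [Ring A] [Algebra K A] (M : Matrix (Fin 2) (Fin 2) A)
    (h1 : qStar p.q M * M = 1) (h2 : M * qStar p.q M = 1) : Oq p →ₐ[K] A :=
  RingQuot.liftAlgHom K
    ⟨FreeAlgebra.lift K (fun ij => M ij.1 ij.2), by
      have hM : (freeMatrix K).map (FreeAlgebra.lift K (fun ij : Fin 2 × Fin 2 => M ij.1 ij.2))
          = M := by ext i j; simp [freeMatrix]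
      intro x y h
      cases h with
      | left i j =>
        rw [← Matrix.map_apply (f := FreeAlgebra.lift K _), Matrix.map_mul, ← qStar_map, hM, h1,
          ← Matrix.map_apply (f := FreeAlgebra.lift K _), Matrix.map_one _ (map_zero _) (map_one _)]
      | right i j =>
        rw [← Matrix.map_apply (f := FreeAlgebra.lift K _), Matrix.map_mul, ← qStar_map, hM, h2,
          ← Matrix.map_apply (f := FreeAlgebra.lift K _),
          Matrix.map_one _ (map_zero _) (map_one _)]⟩

@[simp] lemma lift_u {A : Type*} [Ring A] [Algebra K A] {M : Matrix (Fin 2) (Fin 2) A}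
    (h1 : qStar p.q M * M = 1) (h2 : M * qStar p.q M = 1) (i j : Fin 2) :
    lift M h1 h2 (u p i j) = M i j :=
  (RingQuot.liftAlgHom_mkAlgHom_apply K _ _ _).trans (by
    simp [freeMatrix])

lemma algHom_ext {A : Type*} [Semiring A] [Algebra K A] {φ ψ : Oq p →ₐ[K] A}
    (h : ∀ i j, φ (u p i j) = ψ (u p i j)) : φ = ψ := by
  apply RingQuot.ringQuot_ext'
  apply FreeAlgebra.hom_ext
  funext g
  exact h g.1 g.2

/-- Induction on elements of `O_q(U)`. -/
lemma induction {P : Oq p → Prop} (x : Oq p) (hu : ∀ i j, P (u p i j))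
    (hc : ∀ c : K, P (algebraMap K _ c))
    (hadd : ∀ x y, P x → P y → P (x + y)) (hmul : ∀ x y, P x → P y → P (x * y)) : P x := by
  obtain ⟨y, rfl⟩ := RingQuot.mkAlgHom_surjective K (ORel p) x
  induction y using FreeAlgebra.induction with
  | grade0 r => rw [AlgHom.commutes]; exact hc r
  | grade1 g => exact hu g.1 g.2
  | mul a b ha hb => rw [map_mul]; exact hmul _ _ ha hb
  | add a b ha hb => rw [map_add]; exact hadd _ _ ha hb

variable (p)

/-- The matrix with entries `∑ k, u i k ⊗ u k j`. -/
def comulMatrix : Matrix (Fin 2) (Fin 2) (Oq p ⊗[K] Oq p) :=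
  Matrix.of fun i j => ∑ k, u p i k ⊗ₜ[K] u p k j

lemma comulMatrix_eq : comulMatrix p =
    (u p).map (Algebra.TensorProduct.includeLeft : Oq p →ₐ[K] Oq p ⊗[K] Oq p) *
    (u p).map (Algebra.TensorProduct.includeRight : Oq p →ₐ[K] Oq p ⊗[K] Oq p) := by
  ext i j
  simp [comulMatrix, Matrix.mul_apply]

lemma qStar_comulMatrix : qStar p.q (comulMatrix p) =
    (uStar p).map (Algebra.TensorProduct.includeRight : Oq p →ₐ[K] Oq p ⊗[K] Oq p) *
    (uStar p).map (Algebra.TensorProduct.includeLeft : Oq p →ₐ[K] Oq p ⊗[K] Oq p) := by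
  rw [comulMatrix_eq, qStar_mul _ _ _ _ p.q_ne_zero, qStar_map, qStar_map]
  · rfl
  · intro i j k l
    simp [Commute, SemiconjBy]

lemma mul_mul_mul_eq_one {R : Type*} [Monoid R] {A B C D : R} (h : B * C = 1) (h' : A * D = 1) :
    A * B * (C * D) = 1 := by
  rw [mul_assoc, ← mul_assoc B, h, one_mul, h']

/-- The coproduct of `O_q(U)`: `Δ(u i j) = ∑ k, u i k ⊗ u k j`. -/
def comulHom : Oq p →ₐ[K] Oq p ⊗[K] Oq p :=
  lift (comulMatrix p)
    (by
      rw [qStar_comulMatrix, comulMatrix_eq]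
      apply mul_mul_mul_eq_one <;>
        rw [← Matrix.map_mul, uStar_mul_u, Matrix.map_one _ (map_zero _) (map_one _)])
    (by
      rw [qStar_comulMatrix, comulMatrix_eq]
      apply mul_mul_mul_eq_one <;>
        rw [← Matrix.map_mul, u_mul_uStar, Matrix.map_one _ (map_zero _) (map_one _)])

@[simp] lemma comulHom_u (i j : Fin 2) :
    comulHom p (u p i j) = ∑ k, u p i k ⊗ₜ[K] u p k j := by simp [comulHom, comulMatrix]

/-- The counit of `O_q(U)`: `ε(u) = 1`. -/
def counitHom : Oq p →ₐ[K] K :=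
  lift 1 (by ext i j; fin_cases i <;> fin_cases j <;> simp [qStar])
    (by ext i j; fin_cases i <;> fin_cases j <;> simp [qStar])

@[simp] lemma counitHom_u (i j : Fin 2) :
    counitHom p (u p i j) = (1 : Matrix (Fin 2) (Fin 2) K) i j := by simp [counitHom]

instance : Bialgebra K (Oq p) :=
  Bialgebra.ofAlgHom (comulHom p) (counitHom p)
    (by
      apply algHom_ext
      intro i j
      simp [TensorProduct.add_tmul, TensorProduct.tmul_add]
      abel)
    (by
      apply algHom_ext
      intro i j
      fin_cases i <;> simp)
    (by
      apply algHom_ext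
      intro i j
      fin_cases j <;> simp)

lemma comul_eq (x : Oq p) : Coalgebra.comul (R := K) x = comulHom p x := rfl

lemma counit_eq (x : Oq p) : Coalgebra.counit (R := K) x = counitHom p x := rfl

end Oq

/-! ### The pairing -/

/-- The matrix `⟨u, E⟩`. -/
def matE (p : Param K) : Matrix (Fin 2) (Fin 2) K := !![0, p.sqrt; 0, 0]

/-- The matrix `⟨u, F⟩`. -/
def matF (p : Param K) : Matrix (Fin 2) (Fin 2) K := !![0, 0; p.sqrt⁻¹, 0]

/-- The matrix `⟨u, k⟩`. -/
def matk (p : Param K) : Matrix (Fin 2) (Fin 2) K := !![p.q, 0; 0, p.q⁻¹]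

/-- The matrix `⟨u, k⁻¹⟩`. -/
def matkInv (p : Param K) : Matrix (Fin 2) (Fin 2) K := !![p.q⁻¹, 0; 0, p.q]

section Pairing

variable (p : Param K)

/-- The algebra morphism `y ↦ ⟨y, k⟩`. -/
def homk : Oq p →ₐ[K] K :=
  Oq.lift (matk p)
    (by
      have := p.q_ne_zero
      ext i j; fin_cases i <;> fin_cases j <;> simp [qStar, matk, Matrix.mul_apply, this])
    (by
      have := p.q_ne_zero
      ext i j; fin_cases i <;> fin_cases j <;> simp [qStar, matk, Matrix.mul_apply, this])

/-- The algebra morphism `y ↦ ⟨y, k⁻¹⟩`. -/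
def homkInv : Oq p →ₐ[K] K :=
  Oq.lift (matkInv p)
    (by
      have := p.q_ne_zero
      ext i j; fin_cases i <;> fin_cases j <;> simp [qStar, matkInv, Matrix.mul_apply, this])
    (by
      have := p.q_ne_zero
      ext i j; fin_cases i <;> fin_cases j <;> simp [qStar, matkInv, Matrix.mul_apply, this])

/-- The algebra morphism sending `y` to the matrix with rows `(⟨y, k⟩, ⟨y, E⟩)` and `(0, ε(y))`.
Its multiplicativity amounts to `⟨y y', E⟩ = ⟨y, E⟩ ε(y') + ⟨y, k⟩ ⟨y', E⟩`. -/
def homE : Oq p →ₐ[K] Matrix (Fin 2) (Fin 2) K :=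
  Oq.lift (Matrix.of fun i j => !![matk p i j, matE p i j; 0, (1 : Matrix _ _ K) i j])
    (by
      have := p.q_ne_zero
      ext i j a b
      fin_cases i <;> fin_cases j <;> fin_cases a <;> fin_cases b <;>
        simp [qStar, matk, matE, Matrix.mul_apply, Fin.sum_univ_two, this])
    (by
      have := p.q_ne_zero
      ext i j a b
      fin_cases i <;> fin_cases j <;> fin_cases a <;> fin_cases b <;>
        simp [qStar, matk, matE, Matrix.mul_apply, Fin.sum_univ_two, this])

/-- The algebra morphism sending `y` to the matrix with rows `(ε(y), ⟨y, F⟩)` and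
`(0, ⟨y, k⁻¹⟩)`.
Its multiplicativity amounts to `⟨y y', F⟩ = ⟨y, F⟩ ⟨y', k⁻¹⟩ + ε(y) ⟨y', F⟩`. -/
def homF : Oq p →ₐ[K] Matrix (Fin 2) (Fin 2) K :=
  Oq.lift (Matrix.of fun i j => !![(1 : Matrix _ _ K) i j, matF p i j; 0, matkInv p i j])
    (by
      have := p.q_ne_zero
      ext i j a b
      fin_cases i <;> fin_cases j <;> fin_cases a <;> fin_cases b <;>
        simp [qStar, matkInv, matF, Matrix.mul_apply, Fin.sum_univ_two, this]
      all_goals field_simp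
      all_goals ring)
    (by
      have := p.q_ne_zero
      ext i j a b
      fin_cases i <;> fin_cases j <;> fin_cases a <;> fin_cases b <;>
        simp [qStar, matkInv, matF, Matrix.mul_apply, Fin.sum_univ_two, this]
      all_goals field_simp
      all_goals ring)

/-- The linear functional `y ↦ ⟨y, k⟩`. -/
def funk : Oq p →ₗ[K] K := (homk p).toLinearMap

/-- The linear functional `y ↦ ⟨y, k⁻¹⟩`. -/
def funkInv : Oq p →ₗ[K] K := (homkInv p).toLinearMap

/-- The linear functional `y ↦ ⟨y, E⟩`. -/
def funE : Oq p →ₗ[K] K := Matrix.entryLinearMap K K 0 1 ∘ₗ (homE p).toLinearMap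

/-- The linear functional `y ↦ ⟨y, F⟩`. -/
def funF : Oq p →ₗ[K] K := Matrix.entryLinearMap K K 0 1 ∘ₗ (homF p).toLinearMap


lemma funk_mul (x y : Oq p) : funk p (x * y) = funk p x * funk p y := map_mul (homk p) x y

lemma funkInv_mul (x y : Oq p) : funkInv p (x * y) = funkInv p x * funkInv p y :=
  map_mul (homkInv p) x y

lemma homE_entries (x : Oq p) : homE p x 1 0 = 0 ∧ homE p x 0 0 = funk p x ∧
    homE p x 1 1 = Oq.counitHom p x := by
  induction x using Oq.induction with
  | hu i j => simp [homE, funk, homk]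
  | hc c => simp [Matrix.algebraMap_eq_diagonal, funk]
  | hadd x y hx hy => simp [hx, hy]
  | hmul x y hx hy => simp [Matrix.mul_apply, hx, hy, funk]

lemma funE_mul (x y : Oq p) : funE p (x * y) =
    funE p x * Oq.counitHom p y + funk p x * funE p y := by
  simp only [funE, LinearMap.comp_apply, AlgHom.toLinearMap_apply, map_mul,
    Matrix.entryLinearMap_apply, Matrix.mul_apply, Fin.sum_univ_two, homE_entries]
  ring

lemma homF_entries (x : Oq p) : homF p x 1 0 = 0 ∧ homF p x 0 0 = Oq.counitHom p x ∧
    homF p x 1 1 = funkInv p x := by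
  induction x using Oq.induction with
  | hu i j => simp [homF, funkInv, homkInv]
  | hc c => simp [Matrix.algebraMap_eq_diagonal, funkInv]
  | hadd x y hx hy => simp [hx, hy]
  | hmul x y hx hy => simp [Matrix.mul_apply, hx, hy, funkInv]

lemma funF_mul (x y : Oq p) : funF p (x * y) =
    funF p x * funkInv p y + Oq.counitHom p x * funF p y := by
  simp only [funF, LinearMap.comp_apply, AlgHom.toLinearMap_apply, map_mul,
    Matrix.entryLinearMap_apply, Matrix.mul_apply, Fin.sum_univ_two, homF_entries]
  ring

@[simp] lemma funk_u (i j : Fin 2) : funk p (Oq.u p i j) = matk p i j := by simp [funk, homk]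
@[simp] lemma funkInv_u (i j : Fin 2) : funkInv p (Oq.u p i j) = matkInv p i j := by
  simp [funkInv, homkInv]
@[simp] lemma funE_u (i j : Fin 2) : funE p (Oq.u p i j) = matE p i j := by simp [funE, homE]
@[simp] lemma funF_u (i j : Fin 2) : funF p (Oq.u p i j) = matF p i j := by simp [funF, homF]
@[simp] lemma funk_one : funk p 1 = 1 := map_one (homk p)
@[simp] lemma funkInv_one : funkInv p 1 = 1 := map_one (homkInv p)
@[simp] lemma funE_one : funE p 1 = 0 := by simp [funE]
@[simp] lemma funF_one : funF p 1 = 0 := by simp [funF]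

open LinearMap WithConv

/-- The convolution algebra of linear functionals on `O_q(U)`. -/
abbrev ODual : Type _ := WithConv (Oq p →ₗ[K] K)

variable {p}

lemma conv_u (f g : Oq p →ₗ[K] K) (i j : Fin 2) :
    (toConv f * toConv g : ODual p) (Oq.u p i j) =
      f (Oq.u p i 0) * g (Oq.u p 0 j) + f (Oq.u p i 1) * g (Oq.u p 1 j) := by
  simp [Oq.comul_eq, Fin.sum_univ_two]

lemma conv_one (f g : Oq p →ₗ[K] K) :
    (toConv f * toConv g : ODual p) (1 : Oq p) = f 1 * g 1 := by
  simp [Algebra.TensorProduct.one_def]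

/-- Convolution products of twisted derivations. -/
lemma conv_mul {f g α β γ δ : Oq p →ₗ[K] K}
    (hf : ∀ x y, f (x * y) = f x * β y + α x * f y)
    (hg : ∀ x y, g (x * y) = g x * δ y + γ x * g y) (x y : Oq p) :
    (toConv f * toConv g : ODual p) (x * y) =
      (toConv f * toConv g : ODual p) x * (toConv β * toConv δ : ODual p) y +
      (toConv f * toConv γ : ODual p) x * (toConv β * toConv g : ODual p) y +
      (toConv α * toConv g : ODual p) x * (toConv f * toConv δ : ODual p) y +
      (toConv α * toConv γ : ODual p) x * (toConv f * toConv g : ODual p) y := by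
  simp only [convMul_apply, Oq.comul_eq, map_mul]
  generalize Oq.comulHom p x = s
  generalize Oq.comulHom p y = t
  induction s using TensorProduct.induction_on with
  | zero => simp
  | add s s' h h' => simp only [add_mul, map_add, h, h']; ring
  | tmul a b =>
    induction t using TensorProduct.induction_on with
    | zero => simp
    | add s s' h h' => simp only [mul_add, map_add, h, h']; ring
    | tmul a' b' => simp [hf, hg]; ring

lemma functional_ext {f g : ODual p} (h1 : f (1 : Oq p) = g (1 : Oq p))
    (hu : ∀ i j, f (Oq.u p i j) = g (Oq.u p i j))
    (hmul : ∀ x y, f x = g x → f y = g y → f (x * y) = g (x * y)) : f = g := by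
  ext x
  induction x using Oq.induction with
  | hu i j => exact hu i j
  | hc c =>
    rw [Algebra.algebraMap_eq_smul_one]
    exact (map_smul f.ofConv c 1).trans ((congrArg (c • ·) h1).trans (map_smul g.ofConv c 1).symm)
  | hadd x y hx hy =>
    exact (map_add f.ofConv x y).trans ((congrArg₂ (· + ·) hx hy).trans (map_add g.ofConv x y).symm)
  | hmul x y hx hy => exact hmul x y hx hy

lemma funk_mul' (x y : Oq p) : funk p (x * y) =
    funk p x * funk p y + (0 : Oq p →ₗ[K] K) x * funk p y := by simp [funk_mul]

lemma funkInv_mul' (x y : Oq p) : funkInv p (x * y) =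
    funkInv p x * funkInv p y + (0 : Oq p →ₗ[K] K) x * funkInv p y := by simp [funkInv_mul]

lemma funE_mul' (x y : Oq p) : funE p (x * y) =
    funE p x * (Coalgebra.counit : Oq p →ₗ[K] K) y + funk p x * funE p y := funE_mul p x y

lemma funF_mul' (x y : Oq p) : funF p (x * y) =
    funF p x * funkInv p y + (Coalgebra.counit : Oq p →ₗ[K] K) x * funF p y := funF_mul p x y

lemma toConv_counit : (toConv (Coalgebra.counit : Oq p →ₗ[K] K) : ODual p) = 1 := rfl

variable (p)

lemma conv_k_kInv : (toConv (funk p) * toConv (funkInv p) : ODual p) = 1 := by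
  have := p.q_ne_zero
  apply functional_ext
  · simp [Algebra.TensorProduct.one_def]
  · intro i j
    rw [conv_u]
    fin_cases i <;> fin_cases j <;> simp [matk, matkInv, this, Oq.counit_eq]
  · intro x y hx hy
    rw [conv_mul funk_mul' funkInv_mul', hx, hy]
    simp [Oq.counit_eq]

lemma conv_kInv_k : (toConv (funkInv p) * toConv (funk p) : ODual p) = 1 := by
  have := p.q_ne_zero
  apply functional_ext
  · simp [Algebra.TensorProduct.one_def]
  · intro i j
    rw [conv_u]
    fin_cases i <;> fin_cases j <;> simp [matk, matkInv, this, Oq.counit_eq]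
  · intro x y hx hy
    rw [conv_mul funkInv_mul' funk_mul', hx, hy]
    simp [Oq.counit_eq]

lemma conv_k_E : (toConv (funk p) * toConv (funE p) : ODual p) =
    p.q ^ 2 • (toConv (funE p) * toConv (funk p)) := by
  have := p.q_ne_zero
  apply functional_ext
  · simp [Algebra.TensorProduct.one_def]
  · intro i j
    rw [ofConv_smul, LinearMap.smul_apply, conv_u, conv_u]
    fin_cases i <;> fin_cases j <;> simp [matk, matE]
    field_simp
  · intro x y hx hy
    rw [ofConv_smul, LinearMap.smul_apply] at *
    rw [conv_mul funk_mul' funE_mul', conv_mul funE_mul' funk_mul', hx, hy]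
    simp only [toConv_counit, one_mul, mul_one, toConv_zero, zero_mul, mul_zero]
    simp
    ring

lemma conv_k_F : (toConv (funk p) * toConv (funF p) : ODual p) =
    (p.q ^ 2)⁻¹ • (toConv (funF p) * toConv (funk p)) := by
  have := p.q_ne_zero
  apply functional_ext
  · simp [Algebra.TensorProduct.one_def]
  · intro i j
    rw [ofConv_smul, LinearMap.smul_apply, conv_u, conv_u]
    fin_cases i <;> fin_cases j <;> simp [matk, matF]
    field_simp
  · intro x y hx hy
    rw [ofConv_smul, LinearMap.smul_apply] at *
    rw [conv_mul funk_mul' funF_mul', conv_mul funF_mul' funk_mul', hx, hy]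
    simp only [toConv_counit, one_mul, mul_one, toConv_zero, zero_mul, mul_zero, conv_k_kInv,
      conv_kInv_k]
    simp
    ring

lemma conv_E_F : (toConv (funE p) * toConv (funF p) - toConv (funF p) * toConv (funE p) : ODual p) =
    (p.q - p.q⁻¹)⁻¹ • (toConv (funk p) - toConv (funkInv p)) := by
  have h0 := p.q_sub_ne_zero
  have hs := p.sqrt_ne_zero
  have hkE : (toConv (funE p) * toConv (funkInv p) : ODual p) =
      p.q ^ 2 • (toConv (funkInv p) * toConv (funE p)) := by
    have h := congrArg (fun z => toConv (funkInv p) * z * toConv (funkInv p)) (conv_k_E p)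
    simp only [← mul_assoc, conv_kInv_k, one_mul, mul_smul_comm, smul_mul_assoc] at h
    simpa only [mul_assoc, conv_k_kInv, mul_one] using h
  have hq : p.q ^ 2 ≠ 0 := pow_ne_zero 2 p.q_ne_zero
  apply functional_ext
  · simp [Algebra.TensorProduct.one_def]
  · intro i j
    rw [ofConv_smul, LinearMap.smul_apply, ofConv_sub, LinearMap.sub_apply, conv_u, conv_u]
    fin_cases i <;> fin_cases j <;> simp [matk, matkInv, matE, matF, hs]
    · rw [inv_mul_cancel₀ h0]
    · rw [← neg_sub p.q, mul_neg, inv_mul_cancel₀ h0]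
  · intro x y hx hy
    rw [ofConv_smul, LinearMap.smul_apply, ofConv_sub, LinearMap.sub_apply] at *
    rw [conv_mul funE_mul' funF_mul', conv_mul funF_mul' funE_mul']
    rw [sub_eq_iff_eq_add] at hx hy
    rw [hx, hy]
    simp only [toConv_counit, one_mul, mul_one, conv_k_F, hkE, ofConv_smul, LinearMap.smul_apply,
      ofConv_sub, LinearMap.sub_apply, smul_eq_mul, funk_mul, funkInv_mul]
    linear_combination ((toConv (funF p) * toConv (funk p) : ODual p) x *
      (toConv (funkInv p) * toConv (funE p) : ODual p) y) * inv_mul_cancel₀ hq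

/-- The pairing between `U_q(𝔲)` and `O_q(U)`, as an algebra morphism from `U_q(𝔲)` to
the convolution algebra of linear functionals on `O_q(U)`. -/
def pairingHom : Uq p →ₐ[K] ODual p :=
  Uq.lift (toConv (funE p)) (toConv (funF p)) (toConv (funk p)) (toConv (funkInv p))
    (conv_k_kInv p) (conv_kInv_k p)
    (by rw [conv_k_E, smul_mul_assoc, mul_assoc, conv_k_kInv, mul_one])
    (by rw [conv_k_F, smul_mul_assoc, mul_assoc, conv_k_kInv, mul_one])
    (conv_E_F p)

/-- The pairing `⟨x, y⟩` of `x : U_q(𝔲)` with `y : O_q(U)`. -/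
def pairing (x : Uq p) : Oq p →ₗ[K] K := (pairingHom p x).ofConv

end Pairing

/-! ### The regular actions -/

section Actions

/-- For a linear functional `f`, the map `y ↦ y₍₁₎ f(y₍₂₎)`. -/
def sliceRight {p : Param K} (f : Oq p →ₗ[K] K) : Module.End K (Oq p) :=
  (TensorProduct.rid K (Oq p)).toLinearMap ∘ₗ f.lTensor (Oq p) ∘ₗ Coalgebra.comul

/-- For a linear functional `f`, the map `y ↦ f(y₍₁₎) y₍₂₎`. -/
def sliceLeft {p : Param K} (f : Oq p →ₗ[K] K) : Module.End K (Oq p) :=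
  (TensorProduct.lid K (Oq p)).toLinearMap ∘ₗ f.rTensor (Oq p) ∘ₗ Coalgebra.comul

open LinearMap WithConv

lemma sliceRight_mul {p : Param K} (f g : ODual p) :
    sliceRight (f * g).ofConv = sliceRight f.ofConv * sliceRight g.ofConv := by
  ext y
  have key : ∀ t : Oq p ⊗[K] Oq p,
      Coalgebra.comul (R := K) ((TensorProduct.rid K (Oq p)) (g.ofConv.lTensor (Oq p) t)) =
      (((TensorProduct.rid K (Oq p)).toLinearMap ∘ₗ g.ofConv.lTensor (Oq p)).lTensor (Oq p))
        (TensorProduct.assoc K _ _ _ (Coalgebra.comul.rTensor (Oq p) t)) := by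
    intro t
    induction t using TensorProduct.induction_on with
    | zero => simp
    | add s t hs ht => simp only [map_add, hs, ht]
    | tmul a b =>
      simp only [lTensor_tmul, TensorProduct.rid_tmul, map_smul, rTensor_tmul]
      generalize (Coalgebra.comul (R := K) a) = r
      induction r using TensorProduct.induction_on with
      | zero => simp
      | add s t hs ht => simp only [map_add, TensorProduct.add_tmul, smul_add, hs, ht]
      | tmul c d => simp [TensorProduct.tmul_smul]
  simp only [Module.End.mul_apply]
  conv_rhs => rw [sliceRight, sliceRight]
  simp only [LinearMap.comp_apply, LinearEquiv.coe_coe]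
  rw [key, Coalgebra.coassoc_apply, sliceRight]
  simp only [LinearMap.comp_apply, LinearEquiv.coe_coe]
  congr 1
  generalize (Coalgebra.comul (R := K) y) = t
  induction t using TensorProduct.induction_on with
  | zero => simp
  | add s t hs ht => simp only [map_add, hs, ht]
  | tmul a b =>
    simp only [lTensor_tmul, LinearMap.comp_apply]
    congr 1
    rw [convMul_apply]
    generalize (Coalgebra.comul (R := K) b) = t
    induction t using TensorProduct.induction_on with
    | zero => simp
    | add s t hs ht => simp only [map_add, hs, ht]
    | tmul a b => simp [mul_comm]

lemma sliceLeft_mul {p : Param K} (f g : ODual p) :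
    sliceLeft (f * g).ofConv = sliceLeft g.ofConv * sliceLeft f.ofConv := by
  ext y
  have key : ∀ t : Oq p ⊗[K] Oq p,
      Coalgebra.comul (R := K) ((TensorProduct.lid K (Oq p)) (f.ofConv.rTensor (Oq p) t)) =
      (((TensorProduct.lid K (Oq p)).toLinearMap ∘ₗ f.ofConv.rTensor (Oq p)).rTensor (Oq p))
        ((TensorProduct.assoc K _ _ _).symm (Coalgebra.comul.lTensor (Oq p) t)) := by
    intro t
    induction t using TensorProduct.induction_on with
    | zero => simp
    | add s t hs ht => simp only [map_add, hs, ht]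
    | tmul a b =>
      simp only [lTensor_tmul, TensorProduct.lid_tmul, map_smul, rTensor_tmul]
      generalize (Coalgebra.comul (R := K) b) = r
      induction r using TensorProduct.induction_on with
      | zero => simp
      | add s t hs ht => simp only [map_add, TensorProduct.tmul_add, smul_add, hs, ht]
      | tmul c d => simp [TensorProduct.smul_tmul']
  simp only [Module.End.mul_apply]
  conv_rhs => rw [sliceLeft, sliceLeft]
  simp only [LinearMap.comp_apply, LinearEquiv.coe_coe]
  rw [key, Coalgebra.coassoc_symm_apply, sliceLeft]
  simp only [LinearMap.comp_apply, LinearEquiv.coe_coe]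
  congr 1
  generalize (Coalgebra.comul (R := K) y) = t
  induction t using TensorProduct.induction_on with
  | zero => simp
  | add s t hs ht => simp only [map_add, hs, ht]
  | tmul a b =>
    simp only [rTensor_tmul, LinearMap.comp_apply]
    congr 1
    rw [convMul_apply]
    generalize (Coalgebra.comul (R := K) a) = t
    induction t using TensorProduct.induction_on with
    | zero => simp
    | add s t hs ht => simp only [map_add, hs, ht]
    | tmul a b => simp

lemma slice_comm {p : Param K} (f g : Oq p →ₗ[K] K) :
    sliceRight f * sliceLeft g = sliceLeft g * sliceRight f := by
  ext y
  have key : ∀ t : Oq p ⊗[K] Oq p,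
      Coalgebra.comul (R := K) ((TensorProduct.lid K (Oq p)) (g.rTensor (Oq p) t)) =
      (((TensorProduct.lid K (Oq p)).toLinearMap ∘ₗ g.rTensor (Oq p)).rTensor (Oq p))
        ((TensorProduct.assoc K _ _ _).symm (Coalgebra.comul.lTensor (Oq p) t)) := by
    intro t
    induction t using TensorProduct.induction_on with
    | zero => simp
    | add s t hs ht => simp only [map_add, hs, ht]
    | tmul a b =>
      simp only [lTensor_tmul, TensorProduct.lid_tmul, map_smul, rTensor_tmul]
      generalize (Coalgebra.comul (R := K) b) = r
      induction r using TensorProduct.induction_on with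
      | zero => simp
      | add s t hs ht => simp only [map_add, TensorProduct.tmul_add, smul_add, hs, ht]
      | tmul c d => simp [TensorProduct.smul_tmul']
  simp only [Module.End.mul_apply]
  rw [sliceRight, sliceLeft]
  simp only [LinearMap.comp_apply, LinearEquiv.coe_coe]
  rw [key, Coalgebra.coassoc_symm_apply]
  generalize (Coalgebra.comul (R := K) y) = t
  induction t using TensorProduct.induction_on with
  | zero => simp
  | add s t hs ht => simp only [map_add, hs, ht]
  | tmul a b => simp

lemma sliceRight_one {p : Param K} : sliceRight (1 : ODual p).ofConv = 1 := by
  ext y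
  have h : (1 : ODual p).ofConv = Coalgebra.counit := rfl
  simp [sliceRight, h]

lemma sliceLeft_one {p : Param K} : sliceLeft (1 : ODual p).ofConv = 1 := by
  ext y
  have h : (1 : ODual p).ofConv = Coalgebra.counit := rfl
  simp [sliceLeft, h]

lemma sliceRight_leibniz {p : Param K} {f α β : Oq p →ₗ[K] K}
    (hf : ∀ x y, f (x * y) = f x * β y + α x * f y) (x y : Oq p) :
    sliceRight f (x * y) = sliceRight f x * sliceRight β y + sliceRight α x * sliceRight f y := by
  simp only [sliceRight, LinearMap.comp_apply, LinearEquiv.coe_coe, Oq.comul_eq, map_mul]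
  generalize Oq.comulHom p x = s
  generalize Oq.comulHom p y = t
  induction s using TensorProduct.induction_on with
  | zero => simp
  | add s s' h h' => simp only [add_mul, map_add, h, h']; abel
  | tmul a b =>
    induction t using TensorProduct.induction_on with
    | zero => simp
    | add s s' h h' => simp only [mul_add, map_add, h, h']; abel
    | tmul a' b' => simp [hf, add_smul, smul_smul, mul_comm]

lemma sliceLeft_leibniz {p : Param K} {f α β : Oq p →ₗ[K] K}
    (hf : ∀ x y, f (x * y) = f x * β y + α x * f y) (x y : Oq p) :
    sliceLeft f (x * y) = sliceLeft f x * sliceLeft β y + sliceLeft α x * sliceLeft f y := by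
  simp only [sliceLeft, LinearMap.comp_apply, LinearEquiv.coe_coe, Oq.comul_eq, map_mul]
  generalize Oq.comulHom p x = s
  generalize Oq.comulHom p y = t
  induction s using TensorProduct.induction_on with
  | zero => simp
  | add s s' h h' => simp only [add_mul, map_add, h, h']; abel
  | tmul a b =>
    induction t using TensorProduct.induction_on with
    | zero => simp
    | add s s' h h' => simp only [mul_add, map_add, h, h']; abel
    | tmul a' b' => simp [hf, add_smul, smul_smul, mul_comm]

variable (p : Param K)

/-- The left regular action `x ▷ y = y₍₁₎ ⟨x, y₍₂₎⟩` of `U_q(𝔲)` on `O_q(U)`. -/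
def actL : Uq p →ₐ[K] Module.End K (Oq p) where
  toFun x := sliceRight (pairing p x)
  map_one' := by rw [pairing, map_one, sliceRight_one]
  map_mul' x y := by rw [pairing, map_mul, sliceRight_mul]; rfl
  map_zero' := by ext; simp [pairing, sliceRight]
  map_add' x y := by ext; simp [pairing, sliceRight, LinearMap.lTensor_add]
  commutes' c := by
    rw [pairing, AlgHom.commutes, Algebra.algebraMap_eq_smul_one, Algebra.algebraMap_eq_smul_one,
      ← sliceRight_one (p := p)]
    ext; simp [sliceRight, LinearMap.lTensor_smul]

/-- The right regular action `y ◁ x = ⟨x, y₍₁₎⟩ y₍₂₎` of `U_q(𝔲)` on `O_q(U)`, as a left action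
of the opposite algebra. -/
def actR : (Uq p)ᵐᵒᵖ →ₐ[K] Module.End K (Oq p) where
  toFun x := sliceLeft (pairing p x.unop)
  map_one' := by rw [pairing, MulOpposite.unop_one, map_one, sliceLeft_one]
  map_mul' x y := by rw [pairing, MulOpposite.unop_mul, map_mul, sliceLeft_mul]; rfl
  map_zero' := by ext; simp [pairing, sliceLeft]
  map_add' x y := by ext; simp [pairing, sliceLeft, LinearMap.rTensor_add]
  commutes' c := by
    rw [pairing, MulOpposite.algebraMap_apply, MulOpposite.unop_op, AlgHom.commutes,
      Algebra.algebraMap_eq_smul_one, Algebra.algebraMap_eq_smul_one, ← sliceLeft_one (p := p)]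
    ext; simp [sliceLeft, LinearMap.rTensor_smul]

lemma actL_comm_actR (x : Uq p) (y : (Uq p)ᵐᵒᵖ) : Commute (actL p x) (actR p y) :=
  slice_comm _ _

@[simp] lemma pairing_E : pairing p (Uq.E p) = funE p := by simp [pairing, pairingHom]
@[simp] lemma pairing_F : pairing p (Uq.F p) = funF p := by simp [pairing, pairingHom]
@[simp] lemma pairing_k : pairing p (Uq.k p) = funk p := by simp [pairing, pairingHom]
@[simp] lemma pairing_kInv : pairing p (Uq.kInv p) = funkInv p := by simp [pairing, pairingHom]

variable {p}

open MulOpposite (op)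

lemma actL_E_mul (x y : Oq p) : actL p (Uq.E p) (x * y) =
    actL p (Uq.E p) x * y + actL p (Uq.k p) x * actL p (Uq.E p) y := by
  have h := sliceRight_leibniz (funE_mul' (p := p)) x y
  rw [show sliceRight (Coalgebra.counit : Oq p →ₗ[K] K) = 1 from sliceRight_one] at h
  simpa [actL] using h

lemma actL_F_mul (x y : Oq p) : actL p (Uq.F p) (x * y) =
    actL p (Uq.F p) x * actL p (Uq.kInv p) y + x * actL p (Uq.F p) y := by
  have h := sliceRight_leibniz (funF_mul' (p := p)) x y
  rw [show sliceRight (Coalgebra.counit : Oq p →ₗ[K] K) = 1 from sliceRight_one] at h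
  simpa [actL] using h

lemma actL_k_mul (x y : Oq p) : actL p (Uq.k p) (x * y) =
    actL p (Uq.k p) x * actL p (Uq.k p) y := by
  have h := sliceRight_leibniz (funk_mul' (p := p)) x y
  simpa [actL, show sliceRight (0 : Oq p →ₗ[K] K) = 0 by ext; simp [sliceRight]] using h

lemma actL_kInv_mul (x y : Oq p) : actL p (Uq.kInv p) (x * y) =
    actL p (Uq.kInv p) x * actL p (Uq.kInv p) y := by
  have h := sliceRight_leibniz (funkInv_mul' (p := p)) x y
  simpa [actL, show sliceRight (0 : Oq p →ₗ[K] K) = 0 by ext; simp [sliceRight]] using h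

lemma actR_E_mul (x y : Oq p) : actR p (op (Uq.E p)) (x * y) =
    actR p (op (Uq.E p)) x * y + actR p (op (Uq.k p)) x * actR p (op (Uq.E p)) y := by
  have h := sliceLeft_leibniz (funE_mul' (p := p)) x y
  rw [show sliceLeft (Coalgebra.counit : Oq p →ₗ[K] K) = 1 from sliceLeft_one] at h
  simpa [actR] using h

lemma actR_F_mul (x y : Oq p) : actR p (op (Uq.F p)) (x * y) =
    actR p (op (Uq.F p)) x * actR p (op (Uq.kInv p)) y + x * actR p (op (Uq.F p)) y := by
  have h := sliceLeft_leibniz (funF_mul' (p := p)) x y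
  rw [show sliceLeft (Coalgebra.counit : Oq p →ₗ[K] K) = 1 from sliceLeft_one] at h
  simpa [actR] using h

lemma actR_k_mul (x y : Oq p) : actR p (op (Uq.k p)) (x * y) =
    actR p (op (Uq.k p)) x * actR p (op (Uq.k p)) y := by
  have h := sliceLeft_leibniz (funk_mul' (p := p)) x y
  simpa [actR, show sliceLeft (0 : Oq p →ₗ[K] K) = 0 by ext; simp [sliceLeft]] using h

lemma actR_kInv_mul (x y : Oq p) : actR p (op (Uq.kInv p)) (x * y) =
    actR p (op (Uq.kInv p)) x * actR p (op (Uq.kInv p)) y := by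
  have h := sliceLeft_leibniz (funkInv_mul' (p := p)) x y
  simpa [actR, show sliceLeft (0 : Oq p →ₗ[K] K) = 0 by ext; simp [sliceLeft]] using h

end Actions

/-! ### The Drinfeld double -/

section Double

variable (p : Param K)

open MulOpposite (op unop)

/-- `S⁻¹(x₍₂₎) x₍₁₎ = ε(x)`: the map `invAntipode` is the antipode for the opposite coproduct. -/
lemma invAntipode_spec (x : Uq p) :
    LinearMap.mul' K (Uq p) (TensorProduct.map
      ((MulOpposite.opLinearEquiv K).symm.toLinearMap ∘ₗ (Uq.invAntipode p).toLinearMap)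
      LinearMap.id (TensorProduct.comm K _ _ (Coalgebra.comul (R := K) x))) =
    algebraMap K (Uq p) (Coalgebra.counit (R := K) x) := by
  rw [Uq.comul_eq, Uq.counit_eq]
  induction x using Uq.induction with
  | hE => simp [Uq.comulHom, Uq.counitHom, Uq.invAntipode, mul_assoc, Uq.kInv_mul_k]
  | hF => simp [Uq.comulHom, Uq.counitHom, Uq.invAntipode]
  | hk => simp [Uq.comulHom, Uq.counitHom, Uq.invAntipode, Uq.kInv_mul_k]
  | hkInv => simp [Uq.comulHom, Uq.counitHom, Uq.invAntipode, Uq.k_mul_kInv]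
  | hc c =>
    rw [AlgHom.commutes, AlgHom.commutes, Algebra.algebraMap_eq_smul_one,
      Algebra.algebraMap_eq_smul_one, Algebra.TensorProduct.one_def]
    simp
  | hadd x y hx hy => simp only [map_add, hx, hy]
  | hmul x y hx hy =>
    have key : ∀ s t : Uq p ⊗[K] Uq p, ∀ c : K,
        LinearMap.mul' K (Uq p) (TensorProduct.map
          ((MulOpposite.opLinearEquiv K).symm.toLinearMap ∘ₗ (Uq.invAntipode p).toLinearMap)
          LinearMap.id (TensorProduct.comm K _ _ s)) = algebraMap K (Uq p) c →
        LinearMap.mul' K (Uq p) (TensorProduct.map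
          ((MulOpposite.opLinearEquiv K).symm.toLinearMap ∘ₗ (Uq.invAntipode p).toLinearMap)
          LinearMap.id (TensorProduct.comm K _ _ (s * t))) =
        c • LinearMap.mul' K (Uq p) (TensorProduct.map
          ((MulOpposite.opLinearEquiv K).symm.toLinearMap ∘ₗ (Uq.invAntipode p).toLinearMap)
          LinearMap.id (TensorProduct.comm K _ _ t)) := by
      intro s t c h
      induction t using TensorProduct.induction_on with
      | zero => simp
      | add t t' ht ht' => simp only [mul_add, map_add, ht, ht', smul_add]
      | tmul a b =>
        have key2 : LinearMap.mul' K (Uq p) (TensorProduct.map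
          ((MulOpposite.opLinearEquiv K).symm.toLinearMap ∘ₗ (Uq.invAntipode p).toLinearMap)
          LinearMap.id (TensorProduct.comm K _ _ (s * a ⊗ₜ b))) =
          unop (Uq.invAntipode p b) * LinearMap.mul' K (Uq p) (TensorProduct.map
          ((MulOpposite.opLinearEquiv K).symm.toLinearMap ∘ₗ (Uq.invAntipode p).toLinearMap)
          LinearMap.id (TensorProduct.comm K _ _ s)) * a := by
          clear h
          induction s using TensorProduct.induction_on with
          | zero => simp
          | add t t' ht ht' => simp only [add_mul, mul_add, map_add, ht, ht']
          | tmul x y => simp [mul_assoc]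
        rw [key2, h, Algebra.algebraMap_eq_smul_one]
        simp
    rw [map_mul, key _ _ _ hx, hy, map_mul, map_mul, Algebra.smul_def]

/-- The action of operators on the first factor of `O_q(U) ⊗ U_q(𝔲)`. -/
def onFst : Module.End K (Oq p) →ₐ[K] Module.End K (Oq p ⊗[K] Uq p) :=
  AlgHom.ofLinearMap (LinearMap.rTensorHom (Uq p)) (LinearMap.rTensor_id _ _)
    (fun f g => LinearMap.rTensor_comp _ f g)

/-- The action of operators on the second factor of `O_q(U) ⊗ U_q(𝔲)`. -/
def onSnd : Module.End K (Uq p) →ₐ[K] Module.End K (Oq p ⊗[K] Uq p) :=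
  AlgHom.ofLinearMap (LinearMap.lTensorHom (Oq p)) (LinearMap.lTensor_id _ _)
    (fun f g => LinearMap.lTensor_comp _ f g)

@[simp] lemma onFst_tmul (f : Module.End K (Oq p)) (b : Oq p) (a : Uq p) :
    onFst p f (b ⊗ₜ a) = f b ⊗ₜ a := rfl

@[simp] lemma onSnd_tmul (f : Module.End K (Uq p)) (b : Oq p) (a : Uq p) :
    onSnd p f (b ⊗ₜ a) = b ⊗ₜ f a := rfl

lemma onSnd_comm_onFst (f : Module.End K (Uq p)) (g : Module.End K (Oq p)) :
    Commute (onSnd p f) (onFst p g) := by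
  ext b a
  simp

/-- The algebra morphism sending `y ⊗ z` to the operator `b ⊗ a ↦ (b ◁ S⁻¹(z)) ⊗ y a`
on `O_q(U) ⊗ U_q(𝔲)`. -/
def crossHomAux : Uq p ⊗[K] Uq p →ₐ[K] Module.End K (Oq p ⊗[K] Uq p) :=
  Algebra.TensorProduct.lift ((onSnd p).comp (Algebra.lmul K (Uq p)))
    ((onFst p).comp ((actR p).comp (Uq.invAntipode p)))
    (fun x y => by
      rw [AlgHom.comp_apply, AlgHom.comp_apply]
      exact onSnd_comm_onFst p _ _)

lemma crossHomAux_tmul (y z : Uq p) : crossHomAux p (y ⊗ₜ z) =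
    onSnd p (Algebra.lmul K (Uq p) y) * onFst p (actR p (Uq.invAntipode p z)) := by
  simp [crossHomAux]

/-- The algebra morphism sending `x ⊗ (y ⊗ z)` to the operator
`b ⊗ a ↦ (x ▷ b ◁ S⁻¹(z)) ⊗ y a` on `O_q(U) ⊗ U_q(𝔲)`. -/
def crossHom : Uq p ⊗[K] (Uq p ⊗[K] Uq p) →ₐ[K] Module.End K (Oq p ⊗[K] Uq p) :=
  Algebra.TensorProduct.lift ((onFst p).comp (actL p)) (crossHomAux p)
    (fun x t => by
      rw [AlgHom.comp_apply]
      induction t using TensorProduct.induction_on with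
      | zero => rw [map_zero]; exact Commute.zero_right _
      | add s t hs ht => rw [map_add]; exact hs.add_right ht
      | tmul y z =>
        rw [crossHomAux_tmul]
        exact (onSnd_comm_onFst p _ _).symm.mul_right ((actL_comm_actR p _ _).map (onFst p)))

lemma crossHom_tmul (x y z : Uq p) (b : Oq p) (a : Uq p) :
    crossHom p (x ⊗ₜ (y ⊗ₜ z)) (b ⊗ₜ a) =
      actL p x (actR p (Uq.invAntipode p z) b) ⊗ₜ (y * a) := by
  simp [crossHom, crossHomAux_tmul]

/-- The operator of left multiplication by `x : U_q(𝔲)` on the Drinfeld double: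
`b ⊗ a ↦ (x₍₁₎ ▷ b ◁ S⁻¹(x₍₃₎)) ⊗ x₍₂₎ a`. -/
def leftU : Uq p →ₐ[K] Module.End K (Oq p ⊗[K] Uq p) :=
  (crossHom p).comp
    ((Algebra.TensorProduct.map (AlgHom.id K (Uq p)) (Uq.comulHom p)).comp (Uq.comulHom p))

/-- The operator of left multiplication by `y : O_q(U)` on the Drinfeld double:
`b ⊗ a ↦ y b ⊗ a`. -/
def leftO : Oq p →ₐ[K] Module.End K (Oq p ⊗[K] Uq p) :=
  (onFst p).comp (Algebra.lmul K (Oq p))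

@[simp] lemma leftO_tmul (y b : Oq p) (a : Uq p) : leftO p y (b ⊗ₜ a) = (y * b) ⊗ₜ a := by
  simp [leftO]

/-- The multiplication of the Drinfeld double:
`(b ⊗ a) (b' ⊗ a') = b (a₍₁₎ ▷ b' ◁ S⁻¹(a₍₃₎)) ⊗ a₍₂₎ a'`. -/
def doubleMul : Oq p ⊗[K] Uq p →ₗ[K] Module.End K (Oq p ⊗[K] Uq p) :=
  TensorProduct.lift
    ((LinearMap.mul K (Module.End K (Oq p ⊗[K] Uq p))).compl₁₂
      (leftO p).toLinearMap (leftU p).toLinearMap)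

@[simp] lemma doubleMul_tmul (b : Oq p) (a : Uq p) :
    doubleMul p (b ⊗ₜ a) = leftO p b * leftU p a := by simp [doubleMul]

lemma leftU_E_tmul (b : Oq p) (a : Uq p) : leftU p (Uq.E p) (b ⊗ₜ a) =
    actL p (Uq.E p) b ⊗ₜ a + actL p (Uq.k p) b ⊗ₜ (Uq.E p * a) +
    actL p (Uq.k p) (actR p (Uq.invAntipode p (Uq.E p)) b) ⊗ₜ (Uq.k p * a) := by
  simp [leftU, Uq.comulHom, crossHom_tmul, TensorProduct.tmul_add, Algebra.TensorProduct.one_def,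
    add_assoc]

lemma leftU_F_tmul (b : Oq p) (a : Uq p) : leftU p (Uq.F p) (b ⊗ₜ a) =
    actL p (Uq.F p) (actR p (Uq.invAntipode p (Uq.kInv p)) b) ⊗ₜ (Uq.kInv p * a) +
    actR p (Uq.invAntipode p (Uq.kInv p)) b ⊗ₜ (Uq.F p * a) +
    actR p (Uq.invAntipode p (Uq.F p)) b ⊗ₜ a := by
  simp [leftU, Uq.comulHom, crossHom_tmul, TensorProduct.tmul_add, add_assoc]

lemma leftU_k_tmul (b : Oq p) (a : Uq p) : leftU p (Uq.k p) (b ⊗ₜ a) =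
    actL p (Uq.k p) (actR p (Uq.invAntipode p (Uq.k p)) b) ⊗ₜ (Uq.k p * a) := by
  simp [leftU, Uq.comulHom, crossHom_tmul]

lemma leftU_kInv_tmul (b : Oq p) (a : Uq p) : leftU p (Uq.kInv p) (b ⊗ₜ a) =
    actL p (Uq.kInv p) (actR p (Uq.invAntipode p (Uq.kInv p)) b) ⊗ₜ (Uq.kInv p * a) := by
  simp [leftU, Uq.comulHom, crossHom_tmul]

lemma actR_invAntipode_k (b : Oq p) :
    actR p (Uq.invAntipode p (Uq.k p)) b = actR p (op (Uq.kInv p)) b := by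
  simp [Uq.invAntipode]

lemma actR_invAntipode_kInv (b : Oq p) :
    actR p (Uq.invAntipode p (Uq.kInv p)) b = actR p (op (Uq.k p)) b := by
  simp [Uq.invAntipode]

lemma actR_invAntipode_E (b : Oq p) :
    actR p (Uq.invAntipode p (Uq.E p)) b = -actR p (op (Uq.kInv p)) (actR p (op (Uq.E p)) b) := by
  simp [Uq.invAntipode]

lemma actR_invAntipode_F (b : Oq p) :
    actR p (Uq.invAntipode p (Uq.F p)) b = -actR p (op (Uq.F p)) (actR p (op (Uq.k p)) b) := by
  simp [Uq.invAntipode]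

lemma actR_kInv_k (b : Oq p) : actR p (op (Uq.kInv p)) (actR p (op (Uq.k p)) b) = b := by
  rw [← Module.End.mul_apply, ← map_mul, ← MulOpposite.op_mul, Uq.k_mul_kInv]
  simp

lemma leftU_E_mul_leftO (b : Oq p) : leftU p (Uq.E p) * leftO p b =
    leftO p (actL p (Uq.E p) b) + leftO p (actL p (Uq.k p) b) * leftU p (Uq.E p) +
    leftO p (actL p (Uq.k p) (actR p (Uq.invAntipode p (Uq.E p)) b)) * leftU p (Uq.k p) := by
  ext b' a'
  simp only [TensorProduct.AlgebraTensorModule.curry_apply, TensorProduct.curry_apply,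
    LinearMap.coe_restrictScalars, Module.End.mul_apply, LinearMap.add_apply, leftO_tmul,
    leftU_E_tmul, leftU_k_tmul, map_add, actR_invAntipode_E, actR_invAntipode_k, actR_E_mul,
    actR_kInv_mul, actR_kInv_k, actL_E_mul, actL_k_mul, map_neg, LinearMap.neg_apply, TensorProduct.add_tmul,
    TensorProduct.neg_tmul]
  abel

lemma leftU_F_mul_leftO (b : Oq p) : leftU p (Uq.F p) * leftO p b =
    leftO p (actL p (Uq.F p) (actR p (Uq.invAntipode p (Uq.kInv p)) b)) * leftU p (Uq.kInv p) +
    leftO p (actR p (Uq.invAntipode p (Uq.kInv p)) b) * leftU p (Uq.F p) +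
    leftO p (actR p (Uq.invAntipode p (Uq.F p)) b) := by
  ext b' a'
  simp only [TensorProduct.AlgebraTensorModule.curry_apply, TensorProduct.curry_apply,
    LinearMap.coe_restrictScalars, Module.End.mul_apply, LinearMap.add_apply, leftO_tmul,
    leftU_F_tmul, leftU_kInv_tmul, map_add, actR_invAntipode_F, actR_invAntipode_kInv, actR_F_mul,
    actR_k_mul, actR_kInv_k, actL_F_mul, map_neg, LinearMap.neg_apply, TensorProduct.add_tmul,
    TensorProduct.neg_tmul, neg_add]
  abel

lemma leftU_k_mul_leftO (b : Oq p) : leftU p (Uq.k p) * leftO p b =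
    leftO p (actL p (Uq.k p) (actR p (Uq.invAntipode p (Uq.k p)) b)) * leftU p (Uq.k p) := by
  ext b' a'
  simp only [TensorProduct.AlgebraTensorModule.curry_apply, TensorProduct.curry_apply,
    LinearMap.coe_restrictScalars, Module.End.mul_apply, leftO_tmul,
    leftU_k_tmul, actR_invAntipode_k, actR_kInv_mul, actL_k_mul]

lemma leftU_kInv_mul_leftO (b : Oq p) : leftU p (Uq.kInv p) * leftO p b =
    leftO p (actL p (Uq.kInv p) (actR p (Uq.invAntipode p (Uq.kInv p)) b)) *
      leftU p (Uq.kInv p) := by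
  ext b' a'
  simp only [TensorProduct.AlgebraTensorModule.curry_apply, TensorProduct.curry_apply,
    LinearMap.coe_restrictScalars, Module.End.mul_apply, leftO_tmul,
    leftU_kInv_tmul, actR_invAntipode_kInv, actR_k_mul, actL_kInv_mul]

lemma doubleMul_leftO (b : Oq p) (m : Oq p ⊗[K] Uq p) :
    doubleMul p (leftO p b m) = leftO p b * doubleMul p m := by
  induction m using TensorProduct.induction_on with
  | zero => simp
  | add s t hs ht => simp only [map_add, hs, ht, mul_add]
  | tmul b' a' => simp [mul_assoc]

lemma doubleMul_leftU (a : Uq p) (m : Oq p ⊗[K] Uq p) :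
    doubleMul p (leftU p a m) = leftU p a * doubleMul p m := by
  induction a using Uq.induction generalizing m with
  | hc c => simp [Algebra.algebraMap_eq_smul_one]
  | hadd x y hx hy => simp only [map_add, LinearMap.add_apply, hx, hy, add_mul]
  | hmul x y hx hy => simp only [map_mul, Module.End.mul_apply, hx, hy, mul_assoc]
  | hE =>
    induction m using TensorProduct.induction_on with
    | zero => simp
    | add s t hs ht => simp only [map_add, hs, ht, mul_add]
    | tmul b' a' =>
      simp only [leftU_E_tmul, map_add, doubleMul_tmul, map_mul, ← mul_assoc, leftU_E_mul_leftO,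
        add_mul]
  | hF =>
    induction m using TensorProduct.induction_on with
    | zero => simp
    | add s t hs ht => simp only [map_add, hs, ht, mul_add]
    | tmul b' a' =>
      simp only [leftU_F_tmul, map_add, doubleMul_tmul, map_mul, ← mul_assoc, leftU_F_mul_leftO,
        add_mul]
  | hk =>
    induction m using TensorProduct.induction_on with
    | zero => simp
    | add s t hs ht => simp only [map_add, hs, ht, mul_add]
    | tmul b' a' =>
      simp only [leftU_k_tmul, doubleMul_tmul, map_mul, ← mul_assoc, leftU_k_mul_leftO]
  | hkInv =>
    induction m using TensorProduct.induction_on with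
    | zero => simp
    | add s t hs ht => simp only [map_add, hs, ht, mul_add]
    | tmul b' a' =>
      simp only [leftU_kInv_tmul, doubleMul_tmul, map_mul, ← mul_assoc, leftU_kInv_mul_leftO]

lemma doubleMul_doubleMul (m n : Oq p ⊗[K] Uq p) :
    doubleMul p (doubleMul p m n) = doubleMul p m * doubleMul p n := by
  induction m using TensorProduct.induction_on with
  | zero => simp
  | add s t hs ht => simp only [map_add, LinearMap.add_apply, hs, ht, add_mul]
  | tmul b a =>
    rw [doubleMul_tmul, Module.End.mul_apply, doubleMul_leftO, doubleMul_leftU, mul_assoc]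

lemma actL_one (x : Uq p) : actL p x 1 = algebraMap K _ (Uq.counitHom p x) := by
  induction x using Uq.induction with
  | hE => simp [actL, sliceRight, Uq.counitHom, Algebra.TensorProduct.one_def]
  | hF => simp [actL, sliceRight, Uq.counitHom, Algebra.TensorProduct.one_def]
  | hk => simp [actL, sliceRight, Uq.counitHom, Algebra.TensorProduct.one_def]
  | hkInv => simp [actL, sliceRight, Uq.counitHom, Algebra.TensorProduct.one_def]
  | hc c => simp [Algebra.algebraMap_eq_smul_one]
  | hadd x y hx hy => simp [hx, hy]
  | hmul x y hx hy =>
    simp [hx, hy, Algebra.algebraMap_eq_smul_one, mul_smul, smul_comm (Uq.counitHom p x)]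

lemma actR_one (x : Uq p) : actR p (op x) 1 = algebraMap K _ (Uq.counitHom p x) := by
  induction x using Uq.induction with
  | hE => simp [actR, sliceLeft, Uq.counitHom, Algebra.TensorProduct.one_def]
  | hF => simp [actR, sliceLeft, Uq.counitHom, Algebra.TensorProduct.one_def]
  | hk => simp [actR, sliceLeft, Uq.counitHom, Algebra.TensorProduct.one_def]
  | hkInv => simp [actR, sliceLeft, Uq.counitHom, Algebra.TensorProduct.one_def]
  | hc c =>
    rw [← MulOpposite.algebraMap_apply]
    simp [Algebra.algebraMap_eq_smul_one]
  | hadd x y hx hy => simp [hx, hy]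
  | hmul x y hx hy =>
    simp [hx, hy, Algebra.algebraMap_eq_smul_one, mul_smul, smul_comm (Uq.counitHom p x)]

lemma leftU_one_tmul (a a' : Uq p) : leftU p a (1 ⊗ₜ a') = 1 ⊗ₜ (a * a') := by
  induction a using Uq.induction generalizing a' with
  | hE => simp [leftU_E_tmul, actR_invAntipode_E, actL_one, actR_one, Uq.counitHom]
  | hF => simp [leftU_F_tmul, actR_invAntipode_F, actR_invAntipode_kInv, actL_one, actR_one,
      Uq.counitHom]
  | hk => simp [leftU_k_tmul, actR_invAntipode_k, actL_one, actR_one, Uq.counitHom]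
  | hkInv => simp [leftU_kInv_tmul, actR_invAntipode_kInv, actL_one, actR_one, Uq.counitHom]
  | hc c => simp [Algebra.algebraMap_eq_smul_one]
  | hadd x y hx hy => simp [hx, hy, add_mul, TensorProduct.tmul_add]
  | hmul x y hx hy => simp [hx, hy, mul_assoc]

/-- `U_q((𝔤_ℂ)_{|ℝ})`: the Drinfeld double of the skew-pairing `(x, y) ↦ ⟨y, x⟩` between
`U_q(𝔲)` with the opposite coproduct and `O_q(U)`, as an algebra.
The underlying space is `O_q(U) ⊗ U_q(𝔲)`, with multiplication `doubleMul`. -/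
def Double : Type _ := Oq p ⊗[K] Uq p

namespace Double

instance : AddCommGroup (Double p) := inferInstanceAs (AddCommGroup (Oq p ⊗[K] Uq p))
instance : Module K (Double p) := inferInstanceAs (Module K (Oq p ⊗[K] Uq p))

/-- The identification of vector spaces of `O_q(U) ⊗ U_q(𝔲)` with the double. -/
def equiv : Oq p ⊗[K] Uq p ≃ₗ[K] Double p := LinearEquiv.refl K (Oq p ⊗[K] Uq p)

instance : Mul (Double p) := ⟨fun m n => equiv p (doubleMul p ((equiv p).symm m) ((equiv p).symm n))⟩
instance : One (Double p) := ⟨equiv p (1 ⊗ₜ 1)⟩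

lemma mul_def (m n : Double p) :
    m * n = equiv p (doubleMul p ((equiv p).symm m) ((equiv p).symm n)) := rfl

lemma one_def : (1 : Double p) = equiv p (1 ⊗ₜ 1) := rfl

instance : Ring (Double p) :=
  { (inferInstance : AddCommGroup (Double p)) with
    left_distrib := fun a b c => by simp [mul_def]
    right_distrib := fun a b c => by simp [mul_def]
    zero_mul := fun a => by simp [mul_def]
    mul_zero := fun a => by simp [mul_def]
    mul_assoc := fun a b c => by simp [mul_def, doubleMul_doubleMul]
    one_mul := fun a => by simp [mul_def, one_def]
    mul_one := fun a => by
      obtain ⟨m, rfl⟩ := (equiv p).surjective a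
      rw [mul_def, one_def]
      simp only [LinearEquiv.symm_apply_apply, EmbeddingLike.apply_eq_iff_eq]
      induction m using TensorProduct.induction_on with
      | zero => simp
      | add s t hs ht => simp only [map_add, LinearMap.add_apply, hs, ht]
      | tmul b a => simp [leftU_one_tmul] }

instance : Algebra K (Double p) :=
  Algebra.ofModule (fun c m n => by simp [mul_def]) (fun c m n => by simp [mul_def])

/-- The embedding of `O_q(U)` into the double. -/
def ofO : Oq p →ₐ[K] Double p :=
  AlgHom.ofLinearMap ((equiv p).toLinearMap ∘ₗ (TensorProduct.mk K (Oq p) (Uq p)).flip 1)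
    (by simp [one_def]) (fun x y => by simp [mul_def])

/-- The embedding of `U_q(𝔲)` into the double. -/
def ofU : Uq p →ₐ[K] Double p :=
  AlgHom.ofLinearMap ((equiv p).toLinearMap ∘ₗ TensorProduct.mk K (Oq p) (Uq p) 1)
    (by simp [one_def]) (fun x y => by simp [mul_def, leftU_one_tmul])

end Double

end Double

end

/-! ### The quantized enveloping algebra of `𝔤` -/

section Main

set_option linter.unusedSectionVars false

variable {K : Type*} [Field K] [StarRing K] [Algebra ℂ K] (p : Param K)

open MulOpposite (op)

/-- The imaginary unit of `K`. -/
def imagUnit (K : Type*) [Field K] [Algebra ℂ K] : K := algebraMap ℂ K Complex.I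

/-- The element `θ = i q^{-1/2} (E - F k)` of `U_q(𝔲)`. -/
def theta : Uq p := (imagUnit K * p.sqrt⁻¹) • (Uq.E p - Uq.F p * Uq.k p)

/-- `U_q(𝔨)`: the unital subalgebra of `U_q(𝔲)` generated by `θ`. -/
def Uqk : Subalgebra K (Uq p) := Algebra.adjoin K {theta p}

lemma actR_theta_mul (x y : Oq p) : actR p (op (theta p)) (x * y) =
    actR p (op (theta p)) x * y + actR p (op (Uq.k p)) x * actR p (op (theta p)) y := by
  have h : op (theta p) =
      (imagUnit K * p.sqrt⁻¹) • (op (Uq.E p) - op (Uq.k p) * op (Uq.F p)) := rfl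
  have h' : ∀ b, actR p (op (Uq.k p)) (actR p (op (Uq.kInv p)) b) = b := by
    intro b
    rw [← Module.End.mul_apply, ← map_mul, ← MulOpposite.op_mul, Uq.kInv_mul_k]
    simp
  simp only [h, map_smul, map_sub, map_mul, LinearMap.smul_apply, LinearMap.sub_apply,
    Module.End.mul_apply, actR_E_mul, actR_F_mul, map_add, actR_k_mul, h', smul_mul_assoc,
    mul_smul_comm, ← smul_add]
  congr 1
  noncomm_ring

lemma actR_theta_one : actR p (op (theta p)) 1 = 0 := by
  rw [actR_one]
  simp [theta, Uq.counitHom]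

/-- `O_q(K\U)`: the subalgebra of the `y : O_q(U)` such that `y ◁ θ = 0`. -/
def OqKU : Subalgebra K (Oq p) where
  carrier := {y | actR p (op (theta p)) y = 0}
  zero_mem' := map_zero _
  one_mem' := actR_theta_one p
  add_mem' {x y} hx hy := by
    simp only [Set.mem_ofPred_eq] at *
    rw [map_add, hx, hy, add_zero]
  mul_mem' {x y} hx hy := by
    simp only [Set.mem_ofPred_eq] at *
    rw [actR_theta_mul, hx, hy, zero_mul, mul_zero, add_zero]
  algebraMap_mem' c := by
    simp [Algebra.algebraMap_eq_smul_one, actR_theta_one]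

lemma mem_OqKU {y : Oq p} : y ∈ OqKU p ↔ actR p (op (theta p)) y = 0 := Iff.rfl

/-- The matrix `u* J u` with `J` having rows `(0, -1)` and `(1, 0)`. In terms of the generators
`X`, `Y`, `Z` it has rows `(i q⁻¹ Z, -Y)` and `(X, -i q Z)`. -/
def matrixXYZ : Matrix (Fin 2) (Fin 2) (Oq p) :=
  Oq.uStar p * !![0, -1; 1, 0] * Oq.u p

lemma matrixXYZ_eq_entries : matrixXYZ p =
    !![-(p.q⁻¹ • (Oq.u p 0 1 * Oq.u p 0 0)) - Oq.u p 1 1 * Oq.u p 1 0,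
      -(p.q⁻¹ • (Oq.u p 0 1 * Oq.u p 0 1)) - Oq.u p 1 1 * Oq.u p 1 1;
      Oq.u p 0 0 * Oq.u p 0 0 + p.q • (Oq.u p 1 0 * Oq.u p 1 0),
      Oq.u p 0 0 * Oq.u p 0 1 + p.q • (Oq.u p 1 0 * Oq.u p 1 1)] := by
  ext i j
  fin_cases i <;> fin_cases j <;>
    simp [matrixXYZ, Oq.uStar, qStar, Matrix.mul_apply, Fin.sum_univ_two, sub_eq_add_neg]

lemma imagUnit_ne_zero : imagUnit K ≠ 0 := by
  simp [imagUnit]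

lemma actR_theta_u (i j : Fin 2) : actR p (op (theta p)) (Oq.u p i j) =
    imagUnit K • (if i = 0 then Oq.u p 1 j else -Oq.u p 0 j) := by
  have h : op (theta p) =
      (imagUnit K * p.sqrt⁻¹) • (op (Uq.E p) - op (Uq.k p) * op (Uq.F p)) := rfl
  have hs := p.sqrt_ne_zero
  have hg : ∀ (x : Uq p) (i j : Fin 2), actR p (op x) (Oq.u p i j) =
      pairing p x (Oq.u p i 0) • Oq.u p 0 j + pairing p x (Oq.u p i 1) • Oq.u p 1 j := by
    intro x i j
    simp [actR, sliceLeft, Oq.comul_eq]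
  simp only [h, map_smul, map_sub, map_mul, LinearMap.smul_apply, LinearMap.sub_apply,
    Module.End.mul_apply, hg, pairing_E, pairing_F, pairing_k, funE_u, funF_u, funk_u, map_add]
  fin_cases i
  · simp [matE, matF, matk, smul_smul, hs]
  · simp [matE, matF, matk, smul_smul, p.q_def]
    field_simp

lemma actR_k_u (i j : Fin 2) : actR p (op (Uq.k p)) (Oq.u p i j) =
    (if i = 0 then p.q else p.q⁻¹) • Oq.u p i j := by
  simp [actR, sliceLeft, Oq.comul_eq, matk]
  fin_cases i <;> simp

lemma matrixXYZ_mem (i j : Fin 2) : matrixXYZ p i j ∈ OqKU p := by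
  have hq := p.q_ne_zero
  rw [mem_OqKU, matrixXYZ_eq_entries]
  fin_cases i <;> fin_cases j <;>
    simp [actR_theta_mul, actR_theta_u, actR_k_u, smul_smul, mul_comm (imagUnit K), hq]

/-- The element `X` of `O_q(K\U)`. -/
def X : OqKU p := ⟨matrixXYZ p 1 0, matrixXYZ_mem p 1 0⟩

/-- The element `Y` of `O_q(K\U)`. -/
def Y : OqKU p := -⟨matrixXYZ p 0 1, matrixXYZ_mem p 0 1⟩

/-- The element `Z` of `O_q(K\U)`, determined by `i q⁻¹ Z = (u* J u)₁₁`. -/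
def Z : OqKU p := (imagUnit K * p.q⁻¹)⁻¹ • ⟨matrixXYZ p 0 0, matrixXYZ_mem p 0 0⟩

lemma matrixXYZ_eq : matrixXYZ p =
    !![(imagUnit K * p.q⁻¹) • (Z p : Oq p), -(Y p : Oq p);
      (X p : Oq p), -((imagUnit K * p.q) • (Z p : Oq p))] := by
  have hq := p.q_ne_zero
  have hi := imagUnit_ne_zero (K := K)
  have h1 := congrFun (congrFun (Oq.u_mul_uStar p) 0) 1
  have h2 := congrFun (congrFun (Oq.u_mul_uStar p) 1) 0
  simp [Oq.uStar, qStar, Matrix.mul_apply, Fin.sum_univ_two] at h1 h2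
  ext i j
  fin_cases i <;> fin_cases j
  · have h3 : imagUnit K * p.q⁻¹ * (p.q * (imagUnit K)⁻¹) = 1 := by field_simp
    simp [Z, smul_smul, h3]
  · simp [Y]
  · simp [X]
  · have h3 : imagUnit K * p.q * (p.q * (imagUnit K)⁻¹) = p.q ^ 2 := by field_simp
    simp [Z, smul_smul, h3, matrixXYZ_eq_entries]
    have h4 : Oq.u p 0 0 * Oq.u p 0 1 = p.q • (Oq.u p 0 1 * Oq.u p 0 0) := by
      rw [neg_add_eq_zero] at h1
      rw [← h1, smul_smul, mul_inv_cancel₀ hq, one_smul]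
    have h5 : Oq.u p 1 0 * Oq.u p 1 1 = p.q • (Oq.u p 1 1 * Oq.u p 1 0) := by
      rwa [add_neg_eq_zero] at h2
    rw [h4, h5]
    simp [smul_sub, smul_smul, pow_two, hq, add_comm]

/-- The element `W^{(n)}` of `O_q(K\U)`: `Y ^ n` if `n ≥ 0` and `X ^ (-n)` otherwise. -/
def W (n : ℤ) : OqKU p := if 0 ≤ n then Y p ^ n.toNat else X p ^ (-n).toNat

/-- `U_q(𝔤)`: the subalgebra of the Drinfeld double generated by `U_q(𝔨)` and `O_q(K\U)`. -/
def Uqg : Subalgebra K (Double p) :=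
  Algebra.adjoin K
    (((Uqk p).map (Double.ofU p) : Set (Double p)) ∪ ((OqKU p).map (Double.ofO p)))

/-- The embedding of `O_q(K\U)` into `U_q(𝔤)`. -/
def OqKU.toUqg : OqKU p →ₐ[K] Uqg p :=
  ((Double.ofO p).comp (OqKU p).val).codRestrict (Uqg p) (fun y =>
    Algebra.subset_adjoin (Or.inr ⟨y, y.2, rfl⟩))

/-- The embedding of `U_q(𝔨)` into `U_q(𝔤)`. -/
def Uqk.toUqg : Uqk p →ₐ[K] Uqg p :=
  ((Double.ofU p).comp (Uqk p).val).codRestrict (Uqg p) (fun x =>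
    Algebra.subset_adjoin (Or.inl ⟨x, x.2, rfl⟩))

/-- The element `θ` of `U_q(𝔤)`. -/
def thetaG : Uqg p := Uqk.toUqg p ⟨theta p, Algebra.subset_adjoin rfl⟩

/-- An increasing, exhaustive filtration of a unital algebra, indexed by the natural numbers and
compatible with the unit and the multiplication. -/
structure IsAlgebraFiltration {A : Type*} [Ring A] [Algebra K A] (F : ℕ → Submodule K A) :
    Prop where
  mono : Monotone F
  one_mem : 1 ∈ F 0
  mul_mem : ∀ r s x y, x ∈ F r → y ∈ F s → x * y ∈ F (r + s)
  exhaustive : ∀ x, ∃ r, x ∈ F r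

/-- `O_q(K\U)^{(r)}`: the span of the `W^{(n)} Z^m` with `|n| + m ≤ r`. -/
def OqKU.filt (r : ℕ) : Submodule K (OqKU p) :=
  Submodule.span K {y | ∃ (n : ℤ) (m : ℕ), n.natAbs + m ≤ r ∧ y = W p n * Z p ^ m}

/-- `U_q(𝔤)^{(r)}`: the sum over `n ≤ r` of the subspaces `θ^n O_q(K\U)^{(r-n)}`. -/
def Uqg.filt (r : ℕ) : Submodule K (Uqg p) :=
  ⨆ (n : ℕ) (_ : n ≤ r), (OqKU.filt p (r - n)).map
    (LinearMap.mulLeft K (thetaG p ^ n) ∘ₗ (OqKU.toUqg p).toLinearMap)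

end Main

end QuantumSL2R

end

open scoped TensorProduct

noncomputable section

namespace QuantumSL2R

section

set_option linter.unusedSectionVars false

variable {K : Type*} [Field K] [StarRing K] (p : Param K)

/-! The matrix $M=u^*Ju$ satisfies $M^2=-1$, and its four entries give $YX=1-q^{-2}Z^2$,
$XY=1-q^2Z^2$, $ZX=q^{-2}XZ$, $ZY=q^2YZ$. Straightening with these rules shows that the span of the
$W^{(n)}Z^m$ is closed under multiplication, compatibly with the degree $|n|+m$ (`mul_mem_filt`). It
remains to prove that this span is all of $\mathcal{O}_q(K\backslash U)$ and that the family is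
independent.

Spanning (`spanWZ_eq_top`) comes from diagonalizing $\cdot\triangleleft\theta$ on
$\mathcal{O}_q(U)$. If $c^2=-1$ and $w\triangleleft\theta=-ic[n]w$, with $[n]$ the $q$-integer, then
left multiplication by $u_{0j}+cq^{-n}u_{1j}$ gives an eigenvector for $-ic[n+1]$. Starting from the
span of the $W^{(n)}Z^m$, these multiplications produce spaces `eigenSpan`. Multiplication by
$u_{0j}-cq^{n}u_{1j}$ goes one step back down, or for $n=0$ passes to the chain of $-c$. The two
combinations are linearly independent because $q^{2n}\ne-1$, so the sum of all these spaces is a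
left ideal containing $1$, hence everything (`iSup_eigenSpan`). Since $[n]\ne0$ for $n>0$, the
kernel of $\theta$ is exactly the bottom of the chains.

Independence (`linearIndependent_W_mul_Z_pow`) is seen in a representation with $u_{10}=0$, on
functions on $\mathbb{Z}^2$: the elements $W^{(n)}Z^m$ send the delta function at the origin to
functions whose leading positions are pairwise distinct.

For $U_q(\mathfrak{g})$, the condition $y\triangleleft\theta=0$ reduces the cross relation of the
double to $\theta y=(\theta\triangleright y)+(k\triangleright y)\theta$ (`thetaG_mul_toUqg`). The
left actions of $k^{-1}$ and $\theta$ preserve the filtration of $\mathcal{O}_q(K\backslash U)$, so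
powers of $\theta$ can be moved to the left without raising the degree; this gives the filtration
and the spanning part of the basis statement. For independence, $\theta^ny$ equals
$(k^n\triangleright y)\theta^n$ up to lower powers of $\theta$ on the right. The action of $k^n$ is
invertible, and the powers of $\theta$ are independent in $U_q(\mathfrak{u})$ because $\theta$ has
the infinitely many eigenvalues $[n]$ on $\mathcal{O}_q(U)$. -/

lemma Param.q_pow_ne_one (p : Param K) {n : ℕ} (hn : 0 < n) : p.q ^ n ≠ 1 :=
  p.not_root_of_unity n hn

/-! ### Quadratic relations in `O_q(U)` -/

lemma u00_mul_u11 : Oq.u p 0 0 * Oq.u p 1 1 = 1 + p.q • (Oq.u p 1 0 * Oq.u p 0 1) := by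
  have h := congrFun (congrFun (Oq.uStar_mul_u p) 1) 1
  simp [Oq.uStar, qStar, Matrix.mul_apply, Fin.sum_univ_two] at h
  rw [← h]; abel

lemma u00_mul_u11' : Oq.u p 0 0 * Oq.u p 1 1 = 1 + p.q • (Oq.u p 0 1 * Oq.u p 1 0) := by
  have h := congrFun (congrFun (Oq.u_mul_uStar p) 0) 0
  simp [Oq.uStar, qStar, Matrix.mul_apply, Fin.sum_univ_two] at h
  rw [← h]; abel

lemma u01_mul_u10 : Oq.u p 0 1 * Oq.u p 1 0 = Oq.u p 1 0 * Oq.u p 0 1 := by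
  have h := (u00_mul_u11 p).symm.trans (u00_mul_u11' p)
  exact (smul_right_injective _ p.q_ne_zero (add_left_cancel h)).symm

lemma u11_mul_u00 : Oq.u p 1 1 * Oq.u p 0 0 = 1 + p.q⁻¹ • (Oq.u p 1 0 * Oq.u p 0 1) := by
  have h := congrFun (congrFun (Oq.u_mul_uStar p) 1) 1
  simp [Oq.uStar, qStar, Matrix.mul_apply, Fin.sum_univ_two] at h
  rw [← h]; abel

lemma u00_mul_u10 : Oq.u p 0 0 * Oq.u p 1 0 = p.q • (Oq.u p 1 0 * Oq.u p 0 0) := by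
  have h := congrFun (congrFun (Oq.uStar_mul_u p) 1) 0
  simp [Oq.uStar, qStar, Matrix.mul_apply, Fin.sum_univ_two] at h
  rwa [neg_add_eq_zero, eq_comm] at h

lemma u01_mul_u11 : Oq.u p 0 1 * Oq.u p 1 1 = p.q • (Oq.u p 1 1 * Oq.u p 0 1) := by
  have h := congrFun (congrFun (Oq.uStar_mul_u p) 0) 1
  simp [Oq.uStar, qStar, Matrix.mul_apply, Fin.sum_univ_two] at h
  rw [add_neg_eq_zero] at h
  rw [h, smul_smul, mul_inv_cancel₀ p.q_ne_zero, one_smul]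

/-- The `q`-minors of the matrix `u`. -/
def minorMatrix : Matrix (Fin 2) (Fin 2) K := !![0, 1; -p.q, 0]

/-- One formula for all pairs of columns, so that later computations with combinations of the two
rows need no case distinction on $i,j$. -/
lemma u_minor (i j : Fin 2) : Oq.u p 0 i * Oq.u p 1 j =
    algebraMap K _ (minorMatrix p i j) + p.q • (Oq.u p 1 i * Oq.u p 0 j) := by
  have hq := p.q_ne_zero
  fin_cases i <;> fin_cases j <;>
    simp [minorMatrix, u00_mul_u10, u01_mul_u11, u00_mul_u11, u01_mul_u10, u11_mul_u00,
      Algebra.algebraMap_eq_smul_one, smul_smul, hq]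

end

section

set_option linter.unusedSectionVars false

variable {K : Type*} [Field K] [StarRing K] [Algebra ℂ K] (p : Param K)

lemma imagUnit_mul_self : imagUnit K * imagUnit K = -1 := by
  rw [imagUnit, ← map_mul, Complex.I_mul_I, map_neg, map_one]

/-! ### Relations between the generators `X`, `Y`, `Z` -/

/-- $u^*Ju$ is a conjugate of $J$, because $u^*=u^{-1}$, and $J^2=-1$. The four entries of this
identity are the source of all the relations between $X$, $Y$, $Z$. -/
lemma matrixXYZ_mul_self : matrixXYZ p * matrixXYZ p = -1 := by
  have hJ : (!![0, -1; 1, 0] : Matrix (Fin 2) (Fin 2) (Oq p)) * !![0, -1; 1, 0] = -1 := by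
    ext i j
    fin_cases i <;> fin_cases j <;> simp
  calc matrixXYZ p * matrixXYZ p
      = Oq.uStar p * (!![0, -1; 1, 0] * (Oq.u p * Oq.uStar p) * !![0, -1; 1, 0]) * Oq.u p := by
        simp only [matrixXYZ, mul_assoc]
    _ = -1 := by rw [Oq.u_mul_uStar, mul_one, hJ, mul_neg, mul_one, neg_mul, Oq.uStar_mul_u]

lemma XYZ_entries (i j : Fin 2) : matrixXYZ p i 0 * matrixXYZ p 0 j +
    matrixXYZ p i 1 * matrixXYZ p 1 j = (-1 : Matrix (Fin 2) (Fin 2) (Oq p)) i j := by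
  rw [← matrixXYZ_mul_self, Matrix.mul_apply, Fin.sum_univ_two]

lemma Y_mul_X : Y p * X p = 1 - (p.q⁻¹ ^ 2) • (Z p * Z p) := by
  have h := XYZ_entries p 0 0
  simp [matrixXYZ_eq, smul_smul, mul_mul_mul_comm (imagUnit K), imagUnit_mul_self] at h
  apply Subtype.ext
  push_cast
  linear_combination (norm := module) -h

lemma X_mul_Y : X p * Y p = 1 - (p.q ^ 2) • (Z p * Z p) := by
  have h := XYZ_entries p 1 1
  simp [matrixXYZ_eq, smul_smul, mul_mul_mul_comm (imagUnit K), imagUnit_mul_self] at h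
  apply Subtype.ext
  push_cast
  linear_combination (norm := module) -h

lemma Z_mul_X : Z p * X p = (p.q⁻¹ ^ 2) • (X p * Z p) := by
  have h := XYZ_entries p 1 0
  have hq := p.q_ne_zero
  have hi := imagUnit_ne_zero (K := K)
  simp [matrixXYZ_eq] at h
  have h2 := congrArg ((imagUnit K * p.q)⁻¹ • ·) h
  apply Subtype.ext
  push_cast
  simp only [smul_add, smul_neg, smul_smul, smul_zero] at h2
  linear_combination (norm := (match_scalars <;> field_simp <;> ring)) -h2

lemma Z_mul_Y : Z p * Y p = (p.q ^ 2) • (Y p * Z p) := by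
  have h := XYZ_entries p 0 1
  have hq := p.q_ne_zero
  have hi := imagUnit_ne_zero (K := K)
  simp [matrixXYZ_eq] at h
  have h2 := congrArg ((imagUnit K * p.q⁻¹)⁻¹ • ·) h
  apply Subtype.ext
  push_cast
  simp only [smul_add, smul_neg, smul_smul, smul_zero] at h2
  linear_combination (norm := (match_scalars <;> field_simp <;> ring)) -h2

/-! ### The filtration of `O_q(K\U)` -/

lemma W_natCast (n : ℕ) : W p n = Y p ^ n := by simp [W]

lemma W_neg_natCast (n : ℕ) : W p (-n) = X p ^ n := by
  rcases n with _ | n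
  · simp [W]
  · rw [W, if_neg (by omega), neg_neg, Int.toNat_natCast]

lemma Z_mul_X_pow (n : ℕ) : Z p * X p ^ n = (p.q⁻¹ ^ 2) ^ n • (X p ^ n * Z p) := by
  induction n with
  | zero => simp
  | succ n ih =>
    rw [pow_succ, ← mul_assoc, ih, smul_mul_assoc, mul_assoc, Z_mul_X, mul_smul_comm, smul_smul,
      ← pow_succ, mul_assoc]

lemma Z_mul_Y_pow (n : ℕ) : Z p * Y p ^ n = (p.q ^ 2) ^ n • (Y p ^ n * Z p) := by
  induction n with
  | zero => simp
  | succ n ih =>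
    rw [pow_succ, ← mul_assoc, ih, smul_mul_assoc, mul_assoc, Z_mul_Y, mul_smul_comm, smul_smul,
      ← pow_succ, mul_assoc]

lemma exists_Z_mul_W (n : ℤ) : ∃ c : K, Z p * W p n = c • (W p n * Z p) := by
  obtain ⟨n, rfl | rfl⟩ := n.eq_nat_or_neg
  · exact ⟨_, by rw [W_natCast, Z_mul_Y_pow]⟩
  · exact ⟨_, by rw [W_neg_natCast, Z_mul_X_pow]⟩

lemma W_mul_Z_pow_mem_filt {n : ℤ} {m r : ℕ} (h : n.natAbs + m ≤ r) :
    W p n * Z p ^ m ∈ OqKU.filt p r := Submodule.subset_span ⟨n, m, h, rfl⟩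

lemma filt_mono : Monotone (OqKU.filt p) := fun _ _ h =>
  Submodule.span_mono fun _ ⟨n, m, hnm, hy⟩ => ⟨n, m, hnm.trans h, hy⟩

lemma one_mem_filt (r : ℕ) : 1 ∈ OqKU.filt p r := by
  simpa [W] using W_mul_Z_pow_mem_filt p (n := 0) (m := 0) (r := r) (by simp)

lemma mul_mem_filt_of_basis {x : OqKU p} {r s : ℕ}
    (h : ∀ n m, n.natAbs + m ≤ r → x * (W p n * Z p ^ m) ∈ OqKU.filt p s) {y : OqKU p}
    (hy : y ∈ OqKU.filt p r) : x * y ∈ OqKU.filt p s := by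
  have : OqKU.filt p r ≤ (OqKU.filt p s).comap (LinearMap.mulLeft K x) := by
    refine Submodule.span_le.2 ?_
    rintro _ ⟨n, m, hnm, rfl⟩
    exact h n m hnm
  exact this hy

lemma Z_mul_mem_filt {y : OqKU p} {r : ℕ} (hy : y ∈ OqKU.filt p r) :
    Z p * y ∈ OqKU.filt p (r + 1) := by
  refine mul_mem_filt_of_basis p (fun n m h => ?_) hy
  obtain ⟨c, hc⟩ := exists_Z_mul_W p n
  rw [← mul_assoc, hc, smul_mul_assoc, mul_assoc, ← pow_succ']
  exact Submodule.smul_mem _ _ (W_mul_Z_pow_mem_filt p (by omega))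

/-- Either $X$ prolongs a power of $X$, or it meets a $Y$, and $XY=1-q^2Z^2$ trades that $Y$ for at
most two factors $Z$. In both cases the degree rises by at most one. -/
lemma X_mul_mem_filt {y : OqKU p} {r : ℕ} (hy : y ∈ OqKU.filt p r) :
    X p * y ∈ OqKU.filt p (r + 1) := by
  refine mul_mem_filt_of_basis p (fun n m h => ?_) hy
  by_cases hn : 0 < n
  · obtain ⟨n, rfl⟩ : ∃ k : ℕ, n = (k + 1 : ℕ) := ⟨n.toNat - 1, by omega⟩
    -- Here $r\ge1$ since a factor $Y$ is present, so the truncated `r - 1` is a genuine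
    -- predecessor; the two factors $Z$ then bring the degree back to $r+1$.
    have h' : Y p ^ n * Z p ^ m ∈ OqKU.filt p (r - 1) := by
      rw [← W_natCast]; exact W_mul_Z_pow_mem_filt p (by omega)
    rw [W_natCast, pow_succ', mul_assoc, ← mul_assoc, X_mul_Y, sub_mul, one_mul, smul_mul_assoc,
      mul_assoc (Z p)]
    refine sub_mem (filt_mono p (by omega) h') (Submodule.smul_mem _ _ ?_)
    exact filt_mono p (by omega) (Z_mul_mem_filt p (Z_mul_mem_filt p h'))
  · obtain ⟨n, rfl⟩ : ∃ k : ℕ, n = -(k : ℤ) := ⟨(-n).toNat, by omega⟩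
    rw [← mul_assoc, W_neg_natCast, ← pow_succ', ← W_neg_natCast]
    exact W_mul_Z_pow_mem_filt p (by omega)

lemma Y_mul_mem_filt {y : OqKU p} {r : ℕ} (hy : y ∈ OqKU.filt p r) :
    Y p * y ∈ OqKU.filt p (r + 1) := by
  refine mul_mem_filt_of_basis p (fun n m h => ?_) hy
  by_cases hn : n < 0
  · obtain ⟨n, rfl⟩ : ∃ k : ℕ, n = -((k + 1 : ℕ) : ℤ) := ⟨(-n).toNat - 1, by omega⟩
    have h' : X p ^ n * Z p ^ m ∈ OqKU.filt p (r - 1) := by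
      rw [← W_neg_natCast]; exact W_mul_Z_pow_mem_filt p (by omega)
    rw [W_neg_natCast, pow_succ', mul_assoc, ← mul_assoc, Y_mul_X, sub_mul, one_mul,
      smul_mul_assoc, mul_assoc (Z p)]
    refine sub_mem (filt_mono p (by omega) h') (Submodule.smul_mem _ _ ?_)
    exact filt_mono p (by omega) (Z_mul_mem_filt p (Z_mul_mem_filt p h'))
  · obtain ⟨n, rfl⟩ : ∃ k : ℕ, n = (k : ℤ) := ⟨n.toNat, by omega⟩
    rw [← mul_assoc, W_natCast, ← pow_succ', ← W_natCast]
    exact W_mul_Z_pow_mem_filt p (by omega)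

lemma pow_mul_mem_filt {x : OqKU p}
    (hx : ∀ {y : OqKU p} {r : ℕ}, y ∈ OqKU.filt p r → x * y ∈ OqKU.filt p (r + 1))
    {y : OqKU p} {r : ℕ} (hy : y ∈ OqKU.filt p r) (n : ℕ) :
    x ^ n * y ∈ OqKU.filt p (n + r) := by
  induction n with
  | zero => simpa using hy
  | succ n ih =>
    rw [pow_succ', mul_assoc, add_right_comm]
    exact hx ih

lemma mul_mem_filt {x y : OqKU p} {r s : ℕ} (hx : x ∈ OqKU.filt p r) (hy : y ∈ OqKU.filt p s) :
    x * y ∈ OqKU.filt p (r + s) := by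
  have : OqKU.filt p r ≤ (OqKU.filt p (r + s)).comap (LinearMap.mulRight K y) := by
    refine Submodule.span_le.2 ?_
    rintro _ ⟨n, m, hnm, rfl⟩
    change W p n * Z p ^ m * y ∈ OqKU.filt p (r + s)
    rw [mul_assoc]
    have h := pow_mul_mem_filt p (Z_mul_mem_filt p) hy m
    obtain ⟨n, rfl | rfl⟩ := n.eq_nat_or_neg
    · rw [W_natCast]
      exact filt_mono p (by omega) (pow_mul_mem_filt p (Y_mul_mem_filt p) h n)
    · rw [W_neg_natCast]
      exact filt_mono p (by omega) (pow_mul_mem_filt p (X_mul_mem_filt p) h n)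
  exact this hx

lemma X_mem_filt : X p ∈ OqKU.filt p 1 := by
  simpa using X_mul_mem_filt p (one_mem_filt p 0)

lemma Y_mem_filt : Y p ∈ OqKU.filt p 1 := by
  simpa using Y_mul_mem_filt p (one_mem_filt p 0)

lemma Z_mem_filt : Z p ∈ OqKU.filt p 1 := by
  simpa using Z_mul_mem_filt p (one_mem_filt p 0)

end

section

set_option linter.unusedSectionVars false

variable {K : Type*} [Field K] [StarRing K] (p : Param K)

open MulOpposite (op)

/-! ### Eigenvectors of `θ` in `O_q(U)` -/

/-- The combination `u₀ⱼ + c u₁ⱼ` of the entries of a column of `u`. -/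
def columnComb (c : K) (j : Fin 2) : Oq p := Oq.u p 0 j + c • Oq.u p 1 j

/-- Exchange relation: by `u_minor`, swapping the roles of the two coefficients costs only a scalar.
It moves a lowering combination past a raising one in `columnComb_mul_mem_eigenSpan_pred`. -/
lemma columnComb_mul_columnComb (c s t : K) (i j : Fin 2) :
    columnComb p (-(c * (p.q * s))) i * columnComb p (c * t) j =
      columnComb p (c * (p.q * t)) i * columnComb p (-(c * s)) j +
        (c * (s + t) * minorMatrix p i j) • 1 := by
  simp only [columnComb, add_mul, mul_add, smul_mul_assoc, mul_smul_comm, u_minor,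
    Algebra.algebraMap_eq_smul_one]
  match_scalars <;> ring

/-- At the bottom of the chain, raising and then lowering yields an element of
$\mathcal{O}_q(K\backslash U)$: the mixed terms collapse to a scalar by `u_minor`, and $c^2=-1$
turns the remaining terms into a quadratic expression proportional to $X$, $Y$ or $Z$. -/
lemma columnComb_neg_mul_columnComb {c : K} (hc : c * c = -1) (i j : Fin 2) :
    columnComb p (-(c * p.q)) i * columnComb p c j =
      Oq.u p 0 i * Oq.u p 0 j + p.q • (Oq.u p 1 i * Oq.u p 1 j) +
        (c * minorMatrix p i j) • 1 := by
  simp only [columnComb, add_mul, mul_add, smul_mul_assoc, mul_smul_comm, u_minor,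
    Algebra.algebraMap_eq_smul_one]
  match_scalars <;> first | (ring; done) | linear_combination (-p.q) * hc

/-- The `q`-integer `(q ^ n - q ^ (-n)) / (q - q⁻¹)`. -/
def qInt (n : ℕ) : K := (p.q ^ n - p.q⁻¹ ^ n) / (p.q - p.q⁻¹)

lemma qInt_succ (n : ℕ) : qInt p (n + 1) = p.q * qInt p n + p.q⁻¹ ^ n := by
  have h := p.q_sub_ne_zero
  have hq := p.q_ne_zero
  rw [qInt, qInt, div_eq_iff h, add_mul, mul_assoc, div_mul_cancel₀ _ h]
  ring

/-- This is where $q$ not being a root of unity separates the eigenvalues of $\theta$; it yields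
both $[n]\ne0$ for $n>0$ and infinitely many eigenvalues. -/
lemma qInt_injective : Function.Injective (qInt p) := by
  have hq := p.q_ne_zero
  have key : ∀ m k : ℕ, qInt p m = qInt p (m + (k + 1)) → False := by
    intro m k h
    rw [qInt, qInt, div_left_inj' p.q_sub_ne_zero] at h
    -- The difference $[m+k+1]-[m]$ factors, up to a unit, as this product.
    have h2 : (p.q ^ (k + 1) - 1) * (p.q ^ (2 * m + (k + 1)) + 1) = 0 := by
      rw [inv_pow, inv_pow, pow_add, mul_inv] at h
      rw [pow_add p.q (2 * m), mul_comm 2 m, pow_mul]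
      have hx : p.q ^ m ≠ 0 := pow_ne_zero _ hq
      have hy : p.q ^ (k + 1) ≠ 0 := pow_ne_zero _ hq
      generalize p.q ^ m = x at *
      generalize p.q ^ (k + 1) = y at *
      field_simp at h
      linear_combination -h
    rcases mul_eq_zero.1 h2 with h3 | h3
    · exact p.q_pow_ne_one (Nat.succ_pos k) (sub_eq_zero.1 h3)
    -- The second factor would make a positive power of $q$ equal to $-1$; squaring gives a root of
    -- unity.
    · refine p.q_pow_ne_one (n := 2 * (2 * m + (k + 1))) (by omega) ?_
      rw [mul_comm, pow_mul, eq_neg_of_add_eq_zero_left h3]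
      norm_num
  intro m n h
  rcases lt_trichotomy m n with hmn | hmn | hmn
  · obtain ⟨k, rfl⟩ := Nat.exists_eq_add_of_lt hmn
    exact (key m k h).elim
  · exact hmn
  · obtain ⟨k, rfl⟩ := Nat.exists_eq_add_of_lt hmn
    exact (key n k h.symm).elim

lemma qInt_zero : qInt p 0 = 0 := by simp [qInt]

end

/-! ### Eigenvectors of $\theta$ exhaust $\mathcal{O}_q(U)$; the $W^{(n)}Z^m$ span
$\mathcal{O}_q(K\backslash U)$ -/

section

set_option linter.unusedSectionVars false

variable {K : Type*} [Field K] [StarRing K] [Algebra ℂ K] (p : Param K)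

open MulOpposite (op)

/-- By the twisted Leibniz rule the product stays in the span of $u_{0j}w$ and $u_{1j}w$, on which
$\theta$ acts by a $2\times2$ matrix depending on the eigenvalue of $w$. The coefficient $cq^{-n}$
is the one giving an eigenvector: the $u_{0j}w$ component is the recursion $[n+1]=q[n]+q^{-n}$, and
the $u_{1j}w$ component needs $c^2=-1$. -/
lemma actR_theta_columnComb_mul {c : K} (hc : c * c = -1) (n : ℕ) (j : Fin 2) {w : Oq p}
    (hw : actR p (op (theta p)) w = (-imagUnit K * c * qInt p n) • w) :
    actR p (op (theta p)) (columnComb p (c * p.q⁻¹ ^ n) j * w) =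
      (-imagUnit K * c * qInt p (n + 1)) • (columnComb p (c * p.q⁻¹ ^ n) j * w) := by
  have hq := p.q_ne_zero
  -- The definition of $[n]$ multiplied by $q^{-n}(q-q^{-1})$, needed for the $u_{1j}w$ component.
  have h : p.q⁻¹ ^ n * (qInt p n * (p.q - p.q⁻¹)) = 1 - p.q⁻¹ ^ n * p.q⁻¹ ^ n := by
    rw [qInt, div_mul_cancel₀ _ p.q_sub_ne_zero, mul_sub, ← mul_pow, inv_mul_cancel₀ hq, one_pow]
  rw [actR_theta_mul, hw, qInt_succ]
  simp only [columnComb, map_add, map_smul, actR_theta_u, actR_k_u]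
  simp only [if_true, one_ne_zero, if_false, add_mul, mul_smul_comm, smul_mul_assoc, neg_mul,
    smul_neg]
  match_scalars
  · linear_combination imagUnit K * c * c * h + imagUnit K * hc
  · ring

/-- The linear span of the elements `W^{(n)} Z^m`. -/
def spanWZ : Submodule K (OqKU p) :=
  Submodule.span K (Set.range fun nm : ℤ × ℕ => W p nm.1 * Z p ^ nm.2)

lemma mem_spanWZ {y : OqKU p} : y ∈ spanWZ p ↔ ∃ r, y ∈ OqKU.filt p r := by
  constructor
  · intro hy
    induction hy using Submodule.span_induction with
    | mem _ h =>
      obtain ⟨⟨n, m⟩, rfl⟩ := h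
      exact ⟨_, W_mul_Z_pow_mem_filt p le_rfl⟩
    | zero => exact ⟨0, zero_mem _⟩
    | add x y _ _ hx hy =>
      obtain ⟨r, hr⟩ := hx
      obtain ⟨s, hs⟩ := hy
      exact ⟨max r s, add_mem (filt_mono p (le_max_left r s) hr)
        (filt_mono p (le_max_right r s) hs)⟩
    | smul c x _ hx =>
      obtain ⟨r, hr⟩ := hx
      exact ⟨r, Submodule.smul_mem _ _ hr⟩
  · rintro ⟨r, hr⟩
    exact Submodule.span_mono (by rintro _ ⟨n, m, -, rfl⟩; exact ⟨(n, m), rfl⟩) hr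

lemma mul_mem_spanWZ {x y : OqKU p} (hx : x ∈ spanWZ p) (hy : y ∈ spanWZ p) :
    x * y ∈ spanWZ p := by
  obtain ⟨r, hr⟩ := (mem_spanWZ p).1 hx
  obtain ⟨s, hs⟩ := (mem_spanWZ p).1 hy
  exact (mem_spanWZ p).2 ⟨r + s, mul_mem_filt p hr hs⟩

/-- The subspaces obtained from the span of the `W^{(n)} Z^m` by multiplying repeatedly with
combinations of columns. They consist of eigenvectors of `θ`. -/
def eigenSpan (c : K) : ℕ → Submodule K (Oq p)
  | 0 => (spanWZ p).map (OqKU p).val.toLinearMap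
  | n + 1 => Submodule.span K
      {y | ∃ j, ∃ w ∈ eigenSpan c n, y = columnComb p (c * p.q⁻¹ ^ n) j * w}

lemma columnComb_mul_mem_eigenSpan {c : K} {n : ℕ} (j : Fin 2) {w : Oq p}
    (hw : w ∈ eigenSpan p c n) :
    columnComb p (c * p.q⁻¹ ^ n) j * w ∈ eigenSpan p c (n + 1) :=
  Submodule.subset_span ⟨j, w, hw, rfl⟩

lemma actR_theta_eigenSpan {c : K} (hc : c * c = -1) (n : ℕ) {w : Oq p}
    (hw : w ∈ eigenSpan p c n) :
    actR p (op (theta p)) w = (-imagUnit K * c * qInt p n) • w := by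
  induction n generalizing w with
  | zero =>
    obtain ⟨y, -, rfl⟩ := hw
    rw [qInt_zero, mul_zero, zero_smul]
    exact y.2
  | succ n ih =>
    have : eigenSpan p c (n + 1) ≤
        (actR p (op (theta p))).eigenspace (-imagUnit K * c * qInt p (n + 1)) := by
      refine Submodule.span_le.2 ?_
      rintro _ ⟨j, w, hw, rfl⟩
      exact Module.End.mem_eigenspace_iff.2 (actR_theta_columnComb_mul p hc n j (ih hw))
    exact Module.End.mem_eigenspace_iff.1 (this hw)

/-- Up to nonzero scalars these quadratic elements are the entries of $u^*Ju$, hence multiples of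
$X$, $Y$, $Z$. -/
lemma quadratic_mem_filt (i j : Fin 2) : ∃ y ∈ OqKU.filt p 1,
    Oq.u p 0 i * Oq.u p 0 j + p.q • (Oq.u p 1 i * Oq.u p 1 j) = (y : Oq p) := by
  have h := (matrixXYZ_eq_entries p).symm.trans (matrixXYZ_eq p)
  have hq := p.q_ne_zero
  have h' := fun i j => congrFun (congrFun h i) j
  have h00 := h' 0 0
  have h01 := h' 0 1
  have h10 := h' 1 0
  have h11 := h' 1 1
  simp only [Matrix.of_apply, Matrix.cons_val', Matrix.cons_val] at h00 h01 h10 h11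
  fin_cases i <;> fin_cases j
  · exact ⟨X p, X_mem_filt p, h10⟩
  · exact ⟨-((imagUnit K * p.q) • Z p), neg_mem (Submodule.smul_mem _ _ (Z_mem_filt p)), h11⟩
  · refine ⟨(-p.q * (imagUnit K * p.q⁻¹)) • Z p, Submodule.smul_mem _ _ (Z_mem_filt p), ?_⟩
    rw [SetLike.val_smul, mul_smul, ← h00, smul_sub, smul_neg, smul_smul, neg_mul,
      mul_inv_cancel₀ hq]
    simp
  · refine ⟨p.q • Y p, Submodule.smul_mem _ _ (Y_mem_filt p), ?_⟩
    rw [SetLike.val_smul, ← neg_neg (Y p : Oq p), ← h01, smul_neg, smul_sub, smul_neg, smul_smul,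
      mul_inv_cancel₀ hq]
    simp [add_comm]

/-- Left multiplication by $u_{0i}-cq^{n+1}u_{1i}$ lowers the level by one. The lowering factor is
commuted through the raising factors by the exchange relation, until at the bottom the product of
the two is an element of $\mathcal{O}_q(K\backslash U)$ of degree at most one. -/
lemma columnComb_mul_mem_eigenSpan_pred {c : K} (hc : c * c = -1) {n : ℕ} (i : Fin 2) {w : Oq p}
    (hw : w ∈ eigenSpan p c (n + 1)) :
    columnComb p (-(c * p.q ^ (n + 1))) i * w ∈ eigenSpan p c n := by
  induction n generalizing i w with
  | zero =>
    have : eigenSpan p c 1 ≤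
        (eigenSpan p c 0).comap (LinearMap.mulLeft K (columnComb p (-(c * p.q ^ 1)) i)) := by
      refine Submodule.span_le.2 ?_
      rintro _ ⟨j, _, ⟨w, hw, rfl⟩, rfl⟩
      obtain ⟨y, hy, hy'⟩ := quadratic_mem_filt p i j
      refine ⟨y * w + (c * minorMatrix p i j) • w, add_mem
        (mul_mem_spanWZ p ((mem_spanWZ p).2 ⟨1, hy⟩) hw) (Submodule.smul_mem _ _ hw), ?_⟩
      simp [← mul_assoc, columnComb_neg_mul_columnComb p hc, hy', add_mul]
    exact this hw
  | succ n ih =>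
    have : eigenSpan p c (n + 2) ≤ (eigenSpan p c (n + 1)).comap
        (LinearMap.mulLeft K (columnComb p (-(c * p.q ^ (n + 2))) i)) := by
      refine Submodule.span_le.2 ?_
      rintro _ ⟨j, w, hw, rfl⟩
      change columnComb p (-(c * p.q ^ (n + 2))) i * (columnComb p (c * p.q⁻¹ ^ (n + 1)) j * w) ∈
        eigenSpan p c (n + 1)
      -- Exchange relation with $s=q^{n+1}$, $t=q^{-(n+1)}$: the left factor becomes the raising
      -- combination with coefficient $cq^{-n}$, and the right one the lowering combination covered
      -- by the induction hypothesis.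
      rw [← mul_assoc, pow_succ' p.q (n + 1), columnComb_mul_columnComb, add_mul, mul_assoc,
        pow_succ' p.q⁻¹, mul_inv_cancel_left₀ p.q_ne_zero, smul_mul_assoc, one_mul]
      exact add_mem (columnComb_mul_mem_eigenSpan p _ (ih j hw)) (Submodule.smul_mem _ _ hw)
    exact this hw

/-- The sum of all levels, for both square roots of $-1$, is stable under left multiplication by
each $u_{ij}$, since $u_{0j}$ and $u_{1j}$ are combinations of a raising and a lowering element. It
contains $1$, so it is everything. -/
lemma iSup_eigenSpan : ⨆ i : {c : K // c * c = -1} × ℕ, eigenSpan p i.1 i.2 = ⊤ := by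
  set N := ⨆ i : {c : K // c * c = -1} × ℕ, eigenSpan p i.1 i.2 with hN
  have hle : ∀ {c : K} (_ : c * c = -1) (n : ℕ), eigenSpan p c n ≤ N := fun {c} hc n =>
    le_iSup (fun i : {c : K // c * c = -1} × ℕ => eigenSpan p i.1 i.2) (⟨c, hc⟩, n)
  have hu : ∀ i j, ∀ w ∈ N, Oq.u p i j * w ∈ N := by
    intro i j w hw
    refine (iSup_le ?_ : N ≤ N.comap (LinearMap.mulLeft K (Oq.u p i j))) hw
    rintro ⟨⟨c, hc⟩, n⟩ w hw
    have h1 : columnComb p (c * p.q⁻¹ ^ n) j * w ∈ N :=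
      hle hc _ (columnComb_mul_mem_eigenSpan p j hw)
    have h2 : columnComb p (-(c * p.q ^ n)) j * w ∈ N := by
      cases n with
      | zero =>
        -- At level $0$ there is nothing to lower to; $u_{0j}-cu_{1j}$ is instead the first raising
        -- element for the other root $-c$. This is why both roots enter the sum.
        have hc' : -c * -c = -1 := by rw [neg_mul_neg, hc]
        have := columnComb_mul_mem_eigenSpan p (c := -c) (n := 0) j hw
        simp only [pow_zero, mul_one] at this ⊢
        exact hle hc' 1 this
      | succ n => exact hle hc n (columnComb_mul_mem_eigenSpan_pred p hc j hw)
    have hc0 : c ≠ 0 := by rintro rfl; simp at hc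
    have hne : c * p.q⁻¹ ^ n + c * p.q ^ n ≠ 0 := by
      have hq : p.q ^ n ≠ 0 := pow_ne_zero _ p.q_ne_zero
      intro h
      rw [← mul_add, mul_eq_zero, or_iff_right hc0, inv_pow] at h
      field_simp at h
      -- The coefficients coincide only if $q^{2n}=-1$. For $n=0$ this is excluded by characteristic
      -- zero, inherited from $\mathbb{C}$; for $n>0$ it would give $q^{4n}=1$.
      rcases Nat.eq_zero_or_pos n with rfl | hn
      · have : (2 : K) = 0 := by simpa [one_add_one_eq_two] using h
        have h2 : algebraMap ℂ K 2 = 0 := by rw [map_ofNat, this]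
        simp at h2
      · apply p.q_pow_ne_one (n := 4 * n) (by omega)
        rw [mul_comm, pow_mul]
        linear_combination ((p.q ^ n) ^ 2 - 1) * h
    -- The raising and the lowering element differ by a nonzero multiple of $u_{1j}$.
    have h3 : Oq.u p 1 j * w ∈ N := by
      have := Submodule.smul_mem N (c * p.q⁻¹ ^ n + c * p.q ^ n)⁻¹ (sub_mem h1 h2)
      rwa [columnComb, columnComb, ← sub_mul, add_sub_add_left_eq_sub, ← sub_smul, sub_neg_eq_add,
        smul_mul_assoc, inv_smul_smul₀ hne] at this
    have h4 : Oq.u p 0 j * w ∈ N := by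
      have := sub_mem h1 (Submodule.smul_mem N (c * p.q⁻¹ ^ n) h3)
      simpa [columnComb, add_mul] using this
    fin_cases i
    exacts [h4, h3]
  have hmul : ∀ y w : Oq p, w ∈ N → y * w ∈ N := by
    intro y
    induction y using Oq.induction with
    | hu i j => exact hu i j
    | hc c => intro w hw; rw [← Algebra.smul_def]; exact N.smul_mem c hw
    | hadd x y hx hy => intro w hw; rw [add_mul]; exact add_mem (hx w hw) (hy w hw)
    | hmul x y hx hy => intro w hw; rw [mul_assoc]; exact hx _ (hy w hw)
  refine eq_top_iff.2 fun y _ => ?_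
  have h1 : (1 : Oq p) ∈ N := hle imagUnit_mul_self 0
    ⟨1, (mem_spanWZ p).2 ⟨0, one_mem_filt p 0⟩, rfl⟩
  simpa using hmul y 1 h1

/-- By the decomposition into eigenvectors, $y$ is a combination $s$ of the $W^{(n)}Z^m$ plus a sum
$t$ of eigenvectors with nonzero eigenvalues. Both $y$ and $s$ are killed by $\theta$, hence so is
$t$, and independence of eigenspaces gives $t=0$. -/
lemma spanWZ_eq_top : spanWZ p = ⊤ := by
  refine eq_top_iff.2 fun y _ => ?_
  have hle : (⊤ : Submodule K (Oq p)) ≤ (spanWZ p).map (OqKU p).val.toLinearMap ⊔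
      ⨆ μ ≠ (0 : K), (actR p (op (theta p))).eigenspace μ := by
    rw [← iSup_eigenSpan p]
    refine iSup_le ?_
    rintro ⟨⟨c, hc⟩, n⟩
    cases n with
    | zero => exact le_sup_left
    | succ n =>
      refine le_sup_of_le_right (le_iSup₂_of_le (-imagUnit K * c * qInt p (n + 1)) ?_ ?_)
      · have hc0 : c ≠ 0 := by rintro rfl; simp at hc
        refine mul_ne_zero (mul_ne_zero (neg_ne_zero.2 imagUnit_ne_zero) hc0) ?_
        rw [← qInt_zero p]
        exact (qInt_injective p).ne (Nat.succ_ne_zero n)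
      · intro w hw
        exact Module.End.mem_eigenspace_iff.2 (actR_theta_eigenSpan p hc (n + 1) hw)
  obtain ⟨_, ⟨s, hs, rfl⟩, t, ht, hst⟩ := Submodule.mem_sup.1
    (hle (Submodule.mem_top (x := (y : Oq p))))
  have ht0 : t ∈ (actR p (op (theta p))).eigenspace 0 := by
    have : t = (y - s : OqKU p) := by
      rw [AddSubgroupClass.coe_sub, ← hst]
      simp
    rw [Module.End.mem_eigenspace_iff, zero_smul, this]
    exact (y - s).2
  have h0 := Submodule.disjoint_def.1 ((actR p (op (theta p))).eigenspaces_iSupIndep 0) t ht0 ht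
  have : y = s := by
    apply Subtype.ext
    rw [← hst, h0, add_zero]
    rfl
  rwa [this]

end

section

set_option linter.unusedSectionVars false

variable {K : Type*} [Field K] [StarRing K] (p : Param K)

/-! ### A representation of `O_q(U)` on functions on `ℤ × ℤ` -/

/-- The operator by which `u₀₀` acts. -/
def borelA : Module.End K (ℤ × ℤ → K) where
  toFun f := fun x => p.q ^ x.2 * f (x.1 - 1, x.2)
  map_add' f g := by ext x; simp [mul_add]
  map_smul' c f := by ext x; simp [mul_left_comm]

/-- The operator by which `u₁₁` acts. -/
def borelD : Module.End K (ℤ × ℤ → K) where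
  toFun f := fun x => p.q ^ (-x.2) * f (x.1 + 1, x.2)
  map_add' f g := by ext x; simp [mul_add]
  map_smul' c f := by ext x; simp [mul_left_comm]

/-- The operator by which `u₀₁` acts. -/
def borelB (K : Type*) [Field K] : Module.End K (ℤ × ℤ → K) where
  toFun f := fun x => f (x.1, x.2 - 1)
  map_add' _ _ := rfl
  map_smul' _ _ := rfl

lemma borelA_apply (f : ℤ × ℤ → K) (x : ℤ × ℤ) :
    borelA p f x = p.q ^ x.2 * f (x.1 - 1, x.2) := rfl

lemma borelD_apply (f : ℤ × ℤ → K) (x : ℤ × ℤ) :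
    borelD p f x = p.q ^ (-x.2) * f (x.1 + 1, x.2) := rfl

lemma borelB_apply (f : ℤ × ℤ → K) (x : ℤ × ℤ) : borelB K f x = f (x.1, x.2 - 1) := rfl

lemma borelD_mul_borelA : borelD p * borelA p = 1 := by
  have hq := p.q_ne_zero
  ext f x
  simp only [Module.End.mul_apply, borelA_apply, borelD_apply, Module.End.one_apply,
    add_sub_cancel_right, zpow_neg]
  rw [inv_mul_cancel_left₀ (zpow_ne_zero _ hq)]

lemma borelA_mul_borelD : borelA p * borelD p = 1 := by
  have hq := p.q_ne_zero
  ext f x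
  simp only [Module.End.mul_apply, borelA_apply, borelD_apply, Module.End.one_apply,
    sub_add_cancel, zpow_neg]
  rw [mul_inv_cancel_left₀ (zpow_ne_zero _ hq)]

lemma borelB_mul_borelA : borelB K * borelA p = p.q⁻¹ • (borelA p * borelB K) := by
  have hq := p.q_ne_zero
  ext f x
  simp only [Module.End.mul_apply, borelA_apply, borelB_apply, LinearMap.smul_apply,
    Pi.smul_apply, smul_eq_mul, zpow_sub_one₀ hq]
  ring

lemma borelD_mul_borelB : borelD p * borelB K = p.q⁻¹ • (borelB K * borelD p) := by
  have hq := p.q_ne_zero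
  ext f x
  simp only [Module.End.mul_apply, borelD_apply, borelB_apply, LinearMap.smul_apply,
    Pi.smul_apply, smul_eq_mul, sub_eq_add_neg, neg_add, zpow_add₀ hq, neg_neg, zpow_one]
  field_simp

lemma qStar_mul_upperTriangular {q : K} {A : Type*} [Ring A] [Algebra K A] {a b d : A}
    (had : a * d = 1) (hda : d * a = 1) (hdb : d * b = q⁻¹ • (b * d)) :
    qStar q !![a, b; 0, d] * !![a, b; 0, d] = 1 := by
  ext i j
  fin_cases i <;> fin_cases j <;> simp [qStar, Matrix.mul_apply, had, hda, hdb]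

lemma upperTriangular_mul_qStar {q : K} {A : Type*} [Ring A] [Algebra K A] {a b d : A}
    (had : a * d = 1) (hda : d * a = 1) (hba : b * a = q⁻¹ • (a * b)) :
    !![a, b; 0, d] * qStar q !![a, b; 0, d] = 1 := by
  ext i j
  fin_cases i <;> fin_cases j <;> simp [qStar, Matrix.mul_apply, had, hda, hba]

/-- The representation of `O_q(U)` on functions on `ℤ × ℤ`, in which `u₁₀` acts by zero. -/
def borelRep : Oq p →ₐ[K] Module.End K (ℤ × ℤ → K) :=
  Oq.lift !![borelA p, borelB K; 0, borelD p]
    (qStar_mul_upperTriangular (borelA_mul_borelD p) (borelD_mul_borelA p) (borelD_mul_borelB p))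
    (upperTriangular_mul_qStar (borelA_mul_borelD p) (borelD_mul_borelA p) (borelB_mul_borelA p))

/-- The function `f` has its leading coefficient at `(x, y)`. -/
def HasLeadingAt (f : ℤ × ℤ → K) (x y : ℤ) : Prop :=
  f (x, y) ≠ 0 ∧ ∀ x' y', f (x', y') ≠ 0 → x' - y' = x - y ∧ y' ≤ y

end

/-! ### Leading terms and linear independence of the $W^{(n)}Z^m$ -/

section

set_option linter.unusedSectionVars false

variable {K : Type*} [Field K] [StarRing K] [Algebra ℂ K] (p : Param K)

open MulOpposite (op)

lemma borelRep_X : borelRep p (X p) = borelA p * borelA p := by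
  simp [X, matrixXYZ_eq_entries, borelRep]

lemma borelRep_Y : borelRep p (Y p) =
    p.q⁻¹ • (borelB K * borelB K) + borelD p * borelD p := by
  simp [Y, matrixXYZ_eq_entries, borelRep, add_comm]

lemma borelRep_Z : borelRep p (Z p) = imagUnit K • (borelB K * borelA p) := by
  have hq := p.q_ne_zero
  have h : p.q * (imagUnit K)⁻¹ * p.q⁻¹ = -imagUnit K := by
    have hi := imagUnit_ne_zero (K := K)
    have := imagUnit_mul_self (K := K)
    field_simp
    linear_combination this
  simp [Z, matrixXYZ_eq_entries, borelRep, smul_smul, h]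

lemma HasLeadingAt.borelRep_X {f : ℤ × ℤ → K} {x y : ℤ} (h : HasLeadingAt f x y) :
    HasLeadingAt (borelRep p (X p) f) (x + 2) y := by
  have hq := p.q_ne_zero
  have e : ∀ x' y', borelRep p (X p) f (x', y') = p.q ^ y' * (p.q ^ y' * f (x' - 2, y')) := by
    intro x' y'
    rw [QuantumSL2R.borelRep_X]
    simp only [Module.End.mul_apply, borelA_apply, sub_sub]
    norm_num
  refine ⟨?_, fun x' y' h' => ?_⟩
  · rw [e, add_sub_cancel_right]
    exact mul_ne_zero (zpow_ne_zero _ hq) (mul_ne_zero (zpow_ne_zero _ hq) h.1)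
  · rw [e] at h'
    have := h.2 _ _ (right_ne_zero_of_mul (right_ne_zero_of_mul h'))
    omega

lemma HasLeadingAt.borelRep_Z {f : ℤ × ℤ → K} {x y : ℤ} (h : HasLeadingAt f x y) :
    HasLeadingAt (borelRep p (Z p) f) (x + 1) (y + 1) := by
  have hq := p.q_ne_zero
  have e : ∀ x' y', borelRep p (Z p) f (x', y') =
      imagUnit K * (p.q ^ (y' - 1) * f (x' - 1, y' - 1)) := by
    intro x' y'
    rw [QuantumSL2R.borelRep_Z]
    rfl
  refine ⟨?_, fun x' y' h' => ?_⟩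
  · rw [e, add_sub_cancel_right, add_sub_cancel_right]
    exact mul_ne_zero imagUnit_ne_zero (mul_ne_zero (zpow_ne_zero _ hq) h.1)
  · rw [e] at h'
    have := h.2 _ _ (right_ne_zero_of_mul (right_ne_zero_of_mul h'))
    omega

/-- Here $Y$ acts as a sum of two shifts, by $(0,2)$ and by $(-2,0)$. Both move to the same diagonal
$x-y$, and the second one lands strictly lower, so it cannot cancel the leading term. -/
lemma HasLeadingAt.borelRep_Y {f : ℤ × ℤ → K} {x y : ℤ} (h : HasLeadingAt f x y) :
    HasLeadingAt (borelRep p (Y p) f) x (y + 2) := by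
  have hq := p.q_ne_zero
  have e : ∀ x' y', borelRep p (Y p) f (x', y') =
      p.q⁻¹ * f (x', y' - 2) + p.q ^ (-y') * (p.q ^ (-y') * f (x' + 2, y')) := by
    intro x' y'
    rw [QuantumSL2R.borelRep_Y]
    simp only [LinearMap.add_apply, LinearMap.smul_apply, Module.End.mul_apply, Pi.add_apply,
      Pi.smul_apply, borelB_apply, borelD_apply, sub_sub, add_assoc, smul_eq_mul]
    norm_num
  refine ⟨?_, fun x' y' h' => ?_⟩
  · have h0 : f (x + 2, y + 2) = 0 := by
      by_contra hne
      have := h.2 _ _ hne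
      omega
    rw [e, add_sub_cancel_right, h0, mul_zero, mul_zero, add_zero]
    exact mul_ne_zero (inv_ne_zero hq) h.1
  · rw [e] at h'
    by_cases h1 : f (x', y' - 2) = 0
    · rw [h1, mul_zero, zero_add] at h'
      have := h.2 _ _ (right_ne_zero_of_mul (right_ne_zero_of_mul h'))
      omega
    · have := h.2 _ _ h1
      omega

/-- The leading position determines $(n,m)$: the difference of its coordinates is $-2n$, and the
second coordinate then gives $m$. -/
lemma hasLeadingAt_W_mul_Z_pow (n : ℤ) (m : ℕ) :
    HasLeadingAt (borelRep p (W p n * Z p ^ m : OqKU p) (Pi.single (0, 0) 1))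
      (m + 2 * (-n).toNat) (m + 2 * n.toNat) := by
  have h0 : HasLeadingAt (Pi.single (0, 0) 1 : ℤ × ℤ → K) 0 0 := by
    refine ⟨by simp, fun x y h => ?_⟩
    have : (x, y) = ((0 : ℤ), (0 : ℤ)) := by
      by_contra hne
      exact h (Pi.single_eq_of_ne hne 1)
    obtain ⟨rfl, rfl⟩ := Prod.mk.inj this
    simp
  have hZ : HasLeadingAt (borelRep p (Z p ^ m : OqKU p) (Pi.single (0, 0) 1)) m m := by
    induction m with
    | zero => simpa using h0
    | succ m ih =>
      simpa [pow_succ', Module.End.mul_apply] using ih.borelRep_Z p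
  obtain ⟨n, rfl | rfl⟩ := n.eq_nat_or_neg
  · rw [W_natCast]
    simp only [Int.toNat_natCast, Int.toNat_neg_natCast]
    induction n with
    | zero => simpa using hZ
    | succ n ih =>
      have := ih.borelRep_Y p
      simp only [← Module.End.mul_apply, ← map_mul, ← MulMemClass.coe_mul, ← mul_assoc,
        ← pow_succ'] at this
      convert this using 1
      push_cast
      ring
  · rw [W_neg_natCast]
    simp only [Int.toNat_natCast, neg_neg, Int.toNat_neg_natCast]
    induction n with
    | zero => simpa using hZ
    | succ n ih =>
      have := ih.borelRep_X p
      simp only [← Module.End.mul_apply, ← map_mul, ← MulMemClass.coe_mul, ← mul_assoc,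
        ← pow_succ'] at this
      convert this using 1
      push_cast
      ring

lemma linearIndependent_W_mul_Z_pow :
    LinearIndependent K (fun nm : ℤ × ℕ => W p nm.1 * Z p ^ nm.2) := by
  rw [linearIndependent_iff]
  intro l hl
  by_contra hne
  -- Evaluate at the leading position of the index with the highest second coordinate. Another term
  -- is nonzero there only if it lies on the same diagonal, so has the same $n$, and is at least as
  -- high; by maximality it has the same $m$ as well.
  obtain ⟨i, hi, hmax⟩ := l.support.exists_max_image (fun nm => nm.2 + 2 * nm.1.toNat)
    (Finsupp.support_nonempty_iff.2 hne)
  let ev : OqKU p →ₗ[K] K :=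
    LinearMap.proj ((i.2 : ℤ) + 2 * (-i.1).toNat, (i.2 : ℤ) + 2 * i.1.toNat) ∘ₗ
      LinearMap.applyₗ (Pi.single (0, 0) 1) ∘ₗ (borelRep p).toLinearMap ∘ₗ
        (OqKU p).val.toLinearMap
  have h := congrArg ev hl
  rw [Finsupp.linearCombination_apply, Finsupp.sum, map_sum, map_zero,
    Finset.sum_eq_single_of_mem i hi, map_smul, smul_eq_mul, mul_eq_zero] at h
  · rcases h with h | h
    · exact Finsupp.mem_support_iff.1 hi h
    · exact (hasLeadingAt_W_mul_Z_pow p i.1 i.2).1 h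
  · intro j hj hji
    rw [map_smul, smul_eq_mul, mul_eq_zero]
    right
    by_contra h'
    have h1 := (hasLeadingAt_W_mul_Z_pow p j.1 j.2).2 _ _ h'
    have h2 := hmax j hj
    apply hji
    ext <;> omega

/-- The basis of `O_q(K\U)` consisting of the `W^{(n)} Z^m`. -/
def basisWZ : Module.Basis (ℤ × ℕ) K (OqKU p) :=
  Module.Basis.mk (linearIndependent_W_mul_Z_pow p) (spanWZ_eq_top p).ge

lemma basisWZ_apply (n : ℤ) (m : ℕ) : basisWZ p (n, m) = W p n * Z p ^ m := by
  exact Module.Basis.mk_apply _ _ _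

lemma isAlgebraFiltration_filt : IsAlgebraFiltration (OqKU.filt p) where
  mono := filt_mono p
  one_mem := one_mem_filt p 0
  mul_mem _ _ _ _ := mul_mem_filt p
  exhaustive _ := (mem_spanWZ p).1 (spanWZ_eq_top p ▸ Submodule.mem_top)

/-! ### The powers of `θ` are linearly independent -/

/-- Take the chain with $c=i$, where $-ic=1$. The counit stays equal to $1$ along the products of
the elements $u_{00}+cq^{-n}u_{10}$, which shows that they do not vanish. -/
lemma exists_eigenvector_theta (n : ℕ) :
    ∃ v : Oq p, v ≠ 0 ∧ actR p (op (theta p)) v = qInt p n • v := by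
  have : ∃ v ∈ eigenSpan p (imagUnit K) n, Oq.counitHom p v = 1 := by
    induction n with
    | zero => exact ⟨1, ⟨1, (mem_spanWZ p).2 ⟨0, one_mem_filt p 0⟩, rfl⟩, map_one _⟩
    | succ n ih =>
      obtain ⟨v, hv, hv'⟩ := ih
      exact ⟨_, columnComb_mul_mem_eigenSpan p 0 hv, by simp [columnComb, hv']⟩
  obtain ⟨v, hv, hv'⟩ := this
  refine ⟨v, ?_, ?_⟩
  · rintro rfl
    simp at hv'
  · rw [actR_theta_eigenSpan p imagUnit_mul_self n hv, neg_mul, imagUnit_mul_self, neg_neg, one_mul]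

/-- A polynomial annihilating $\theta$ vanishes at every eigenvalue of $\theta$, in particular at
all the distinct $q$-integers $[n]$. -/
lemma linearIndependent_theta_pow : LinearIndependent K (fun n : ℕ => theta p ^ n) := by
  suffices h : Function.Injective (Polynomial.aeval (R := K) (theta p)) by
    have := (Polynomial.basisMonomials K).linearIndependent.map'
      (Polynomial.aeval (theta p)).toLinearMap (LinearMap.ker_eq_bot.2 h)
    have e : (fun n : ℕ => theta p ^ n) =
        (Polynomial.aeval (theta p)).toLinearMap ∘ Polynomial.basisMonomials K := by
      funext n
      simp
    rw [e]
    exact this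
  rw [injective_iff_map_eq_zero]
  intro P hP
  refine Polynomial.eq_zero_of_infinite_isRoot P
    ((Set.infinite_range_of_injective (qInt_injective p)).mono ?_)
  rintro _ ⟨n, rfl⟩
  obtain ⟨v, hv0, hv⟩ := exists_eigenvector_theta p n
  have h1 := Module.End.aeval_apply_of_hasEigenvector (p := P)
    ⟨Module.End.mem_eigenspace_iff.2 hv, hv0⟩
  -- Powers of a single element are unaffected by passing to the opposite algebra.
  have h2 : Polynomial.aeval (actR p (op (theta p))) P =
      actR p (op (Polynomial.aeval (theta p) P)) := by
    rw [Polynomial.aeval_algHom_apply]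
    congr 1
    simp [Polynomial.aeval_eq_sum_range]
  rw [h2, hP, MulOpposite.op_zero, map_zero, LinearMap.zero_apply, eq_comm,
    smul_eq_zero, or_iff_left hv0] at h1
  exact h1

/-! ### The left regular action on `O_q(K\U)` -/

lemma theta_eq : theta p = (imagUnit K * p.sqrt⁻¹) • (Uq.E p - Uq.F p * Uq.k p) := rfl

lemma actL_k_kInv (y : Oq p) : actL p (Uq.k p) (actL p (Uq.kInv p) y) = y := by
  rw [← Module.End.mul_apply, ← map_mul, Uq.k_mul_kInv, map_one, Module.End.one_apply]

lemma actL_kInv_k (y : Oq p) : actL p (Uq.kInv p) (actL p (Uq.k p) y) = y := by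
  rw [← Module.End.mul_apply, ← map_mul, Uq.kInv_mul_k, map_one, Module.End.one_apply]

lemma actL_theta_mul (x y : Oq p) : actL p (theta p) (x * y) =
    actL p (theta p) x * y + actL p (Uq.k p) x * actL p (theta p) y := by
  simp only [theta_eq, map_smul, map_sub, map_mul, LinearMap.smul_apply, LinearMap.sub_apply,
    Module.End.mul_apply, actL_E_mul, actL_F_mul, actL_k_mul, actL_kInv_k, smul_mul_assoc,
    mul_smul_comm, ← smul_add]
  congr 1
  noncomm_ring

lemma actL_u (x : Uq p) (i j : Fin 2) : actL p x (Oq.u p i j) =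
    pairing p x (Oq.u p 0 j) • Oq.u p i 0 + pairing p x (Oq.u p 1 j) • Oq.u p i 1 := by
  simp [actL, sliceRight, Oq.comul_eq]

lemma actL_k_u (i j : Fin 2) : actL p (Uq.k p) (Oq.u p i j) = matk p j j • Oq.u p i j := by
  rw [actL_u]
  fin_cases j <;> simp [matk]

lemma actL_kInv_u (i j : Fin 2) :
    actL p (Uq.kInv p) (Oq.u p i j) = matkInv p j j • Oq.u p i j := by
  rw [actL_u]
  fin_cases j <;> simp [matkInv]

lemma actL_theta_u (i j : Fin 2) : actL p (theta p) (Oq.u p i j) =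
    (if j = 0 then -imagUnit K else imagUnit K) • Oq.u p i (1 - j) := by
  have hs := p.sqrt_ne_zero
  simp only [theta_eq, map_smul, map_sub, map_mul, LinearMap.smul_apply, LinearMap.sub_apply,
    Module.End.mul_apply, actL_u, pairing_E, pairing_F, pairing_k, funE_u, funF_u, funk_u, map_add]
  fin_cases j
  · simp [matE, matF, matk, smul_smul, p.q_def]
    field_simp
  · simp [matE, matF, matk, smul_smul, hs]

/-- The left regular action of `U_q(𝔲)` on `O_q(K\U)`. -/
def leftAct : Uq p →ₐ[K] Module.End K (OqKU p) :=
  AlgHom.ofLinearMap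
    { toFun x :=
        { toFun y := ⟨actL p x y, by
            have h := LinearMap.congr_fun (actL_comm_actR p x (op (theta p))) (y : Oq p)
            rw [mem_OqKU, ← Module.End.mul_apply, ← h, Module.End.mul_apply, (mem_OqKU p).1 y.2,
              map_zero]⟩
          map_add' _ _ := Subtype.ext (map_add _ _ _)
          map_smul' _ _ := Subtype.ext (map_smul _ _ _) }
      map_add' _ _ := by
        ext1 y
        exact Subtype.ext (by simp)
      map_smul' _ _ := by
        ext1 y
        exact Subtype.ext (by simp) }
    (by
      ext1 y
      exact Subtype.ext (by simp))
    (fun _ _ => by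
      ext1 y
      exact Subtype.ext (by simp))

@[simp] lemma coe_leftAct (x : Uq p) (y : OqKU p) :
    (leftAct p x y : Oq p) = actL p x y := rfl

lemma leftAct_k_kInv (y : OqKU p) : leftAct p (Uq.k p) (leftAct p (Uq.kInv p) y) = y :=
  Subtype.ext (actL_k_kInv p y)

/-- The elements `u₀ᵢ u₀ⱼ + q u₁ᵢ u₁ⱼ` of `O_q(U)`, which span the same space as `X`, `Y`, `Z`. -/
def quadratic (i j : Fin 2) : Oq p :=
  Oq.u p 0 i * Oq.u p 0 j + p.q • (Oq.u p 1 i * Oq.u p 1 j)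

lemma actL_k_quadratic (i j : Fin 2) :
    actL p (Uq.k p) (quadratic p i j) = (matk p i i * matk p j j) • quadratic p i j := by
  simp only [quadratic, map_add, map_smul, actL_k_mul, actL_k_u, smul_mul_smul_comm, smul_add]
  module

lemma actL_kInv_quadratic (i j : Fin 2) :
    actL p (Uq.kInv p) (quadratic p i j) = (matkInv p i i * matkInv p j j) • quadratic p i j := by
  simp only [quadratic, map_add, map_smul, actL_kInv_mul, actL_kInv_u, smul_mul_smul_comm, smul_add]
  module

lemma actL_theta_quadratic (i j : Fin 2) : actL p (theta p) (quadratic p i j) =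
    (if i = 0 then -imagUnit K else imagUnit K) • quadratic p (1 - i) j +
      (matk p i i * if j = 0 then -imagUnit K else imagUnit K) • quadratic p i (1 - j) := by
  simp only [quadratic, map_add, map_smul, actL_theta_mul, actL_theta_u, actL_k_u,
    mul_smul_comm, smul_mul_assoc]
  module

/-- The quadratic elements are eigenvectors of $k^{\pm1}$, and $\theta$ sends each of them to a
combination of two others; so the left actions preserve degree at most one. -/
lemma leftAct_mem_filt_one {y : OqKU p} (hy : ∃ c : K, ∃ i j, (y : Oq p) = c • quadratic p i j) :
    leftAct p (Uq.k p) y ∈ OqKU.filt p 1 ∧ leftAct p (Uq.kInv p) y ∈ OqKU.filt p 1 ∧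
      leftAct p (theta p) y ∈ OqKU.filt p 1 := by
  obtain ⟨c, i, j, hy⟩ := hy
  have key : ∀ (z : OqKU p) (a b : K) (i j i' j' : Fin 2),
      (z : Oq p) = a • quadratic p i j + b • quadratic p i' j' → z ∈ OqKU.filt p 1 := by
    intro z a b i j i' j' hz
    obtain ⟨y, hy, hy'⟩ := quadratic_mem_filt p i j
    obtain ⟨w, hw, hw'⟩ := quadratic_mem_filt p i' j'
    have : z = a • y + b • w := by
      apply Subtype.ext
      rw [hz, quadratic, quadratic, hy', hw']
      rfl
    rw [this]
    exact add_mem (Submodule.smul_mem _ _ hy) (Submodule.smul_mem _ _ hw)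
  -- For $k$ and $k^{-1}$ one term suffices; the second gets coefficient $0$ and arbitrary indices.
  refine ⟨key _ (c * (matk p i i * matk p j j)) 0 i j i j ?_,
    key _ (c * (matkInv p i i * matkInv p j j)) 0 i j i j ?_,
    key _ (c * if i = 0 then -imagUnit K else imagUnit K)
      (c * (matk p i i * if j = 0 then -imagUnit K else imagUnit K)) (1 - i) j i (1 - j) ?_⟩
  · rw [coe_leftAct, hy, map_smul, actL_k_quadratic]
    module
  · rw [coe_leftAct, hy, map_smul, actL_kInv_quadratic]
    module
  · rw [coe_leftAct, hy, map_smul, actL_theta_quadratic]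
    module

lemma X_eq_quadratic : (X p : Oq p) = (1 : K) • quadratic p 0 0 := by
  simp [X, matrixXYZ_eq_entries, quadratic]

lemma Y_eq_quadratic : (Y p : Oq p) = p.q⁻¹ • quadratic p 1 1 := by
  have hq := p.q_ne_zero
  simp [Y, matrixXYZ_eq_entries, quadratic, smul_smul, hq, add_comm]

lemma Z_eq_quadratic : (Z p : Oq p) = (-(imagUnit K * p.q)⁻¹) • quadratic p 0 1 := by
  have h := congrFun (congrFun ((matrixXYZ_eq_entries p).symm.trans (matrixXYZ_eq p)) 1) 1
  have h0 : imagUnit K * p.q ≠ 0 := mul_ne_zero imagUnit_ne_zero p.q_ne_zero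
  simp only [Matrix.of_apply, Matrix.cons_val', Matrix.cons_val] at h
  rw [quadratic, h, smul_neg, neg_smul, neg_neg, inv_smul_smul₀ h0]

/-- Common induction for operators obeying a twisted Leibniz rule: a basis element $W^{(n)}Z^m$ is a
product of $|n|+m$ generators, each a multiple of a quadratic element, so it suffices to control
multiplication by one such factor. -/
lemma map_mem_filt {T : Module.End K (OqKU p)} (h1 : T 1 ∈ OqKU.filt p 0)
    (h : ∀ x : OqKU p, (∃ c : K, ∃ i j, (x : Oq p) = c • quadratic p i j) → ∀ r,
      ∀ w ∈ OqKU.filt p r, T w ∈ OqKU.filt p r → T (x * w) ∈ OqKU.filt p (1 + r))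
    {r : ℕ} {y : OqKU p} (hy : y ∈ OqKU.filt p r) : T y ∈ OqKU.filt p r := by
  have hpow : ∀ x ∈ OqKU.filt p 1, (∃ c : K, ∃ i j, (x : Oq p) = c • quadratic p i j) →
      ∀ (n r : ℕ), ∀ w ∈ OqKU.filt p r, T w ∈ OqKU.filt p r →
        x ^ n * w ∈ OqKU.filt p (n + r) ∧ T (x ^ n * w) ∈ OqKU.filt p (n + r) := by
    intro x hx hx' n r w hw hTw
    induction n with
    | zero => simpa using ⟨hw, hTw⟩
    | succ n ih =>
      rw [pow_succ', mul_assoc, show n + 1 + r = 1 + (n + r) by ring]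
      exact ⟨mul_mem_filt p hx ih.1, h x hx' _ _ ih.1 ih.2⟩
  refine (Submodule.span_le.2 ?_ : OqKU.filt p r ≤ (OqKU.filt p r).comap T) hy
  rintro _ ⟨n, m, hnm, rfl⟩
  have hZ := hpow (Z p) (Z_mem_filt p) ⟨_, _, _, Z_eq_quadratic p⟩ m 0 1 (one_mem_filt p 0) h1
  rw [mul_one] at hZ
  obtain ⟨n, rfl | rfl⟩ := n.eq_nat_or_neg
  · rw [W_natCast]
    exact filt_mono p (by omega)
      (hpow (Y p) (Y_mem_filt p) ⟨_, _, _, Y_eq_quadratic p⟩ n _ _ hZ.1 hZ.2).2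
  · rw [W_neg_natCast]
    exact filt_mono p (by omega)
      (hpow (X p) (X_mem_filt p) ⟨_, _, _, X_eq_quadratic p⟩ n _ _ hZ.1 hZ.2).2

lemma leftAct_one_mem_filt (x : Uq p) : leftAct p x 1 ∈ OqKU.filt p 0 := by
  have : leftAct p x 1 = Uq.counitHom p x • 1 := by
    apply Subtype.ext
    rw [coe_leftAct, OneMemClass.coe_one, actL_one, Algebra.algebraMap_eq_smul_one]
    rfl
  rw [this]
  exact Submodule.smul_mem _ _ (one_mem_filt p 0)

lemma leftAct_kInv_mem_filt {r : ℕ} {y : OqKU p} (hy : y ∈ OqKU.filt p r) :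
    leftAct p (Uq.kInv p) y ∈ OqKU.filt p r := by
  refine map_mem_filt p (leftAct_one_mem_filt p _) (fun x hx r w _ hTw => ?_) hy
  have : leftAct p (Uq.kInv p) (x * w) = leftAct p (Uq.kInv p) x * leftAct p (Uq.kInv p) w :=
    Subtype.ext (actL_kInv_mul _ _)
  rw [this]
  exact mul_mem_filt p (leftAct_mem_filt_one p hx).2.1 hTw

lemma leftAct_theta_mem_filt {r : ℕ} {y : OqKU p} (hy : y ∈ OqKU.filt p r) :
    leftAct p (theta p) y ∈ OqKU.filt p r := by
  refine map_mem_filt p (leftAct_one_mem_filt p _) (fun x hx r w hw hTw => ?_) hy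
  have : leftAct p (theta p) (x * w) =
      leftAct p (theta p) x * w + leftAct p (Uq.k p) x * leftAct p (theta p) w :=
    Subtype.ext (actL_theta_mul p _ _)
  rw [this]
  exact add_mem (mul_mem_filt p (leftAct_mem_filt_one p hx).2.2 hw)
    (mul_mem_filt p (leftAct_mem_filt_one p hx).1 hTw)

/-! ### Commutation relations in the double -/

lemma ofO_eq (b : Oq p) : Double.ofO p b = Double.equiv p (b ⊗ₜ 1) := rfl

lemma ofU_eq (a : Uq p) : Double.ofU p a = Double.equiv p (1 ⊗ₜ a) := rfl

lemma ofO_mul_ofU (b : Oq p) (a : Uq p) :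
    Double.ofO p b * Double.ofU p a = Double.equiv p (b ⊗ₜ a) := by
  simp [ofO_eq, ofU_eq, Double.mul_def]

lemma ofU_mul_ofO (a : Uq p) (b : Oq p) :
    Double.ofU p a * Double.ofO p b = Double.equiv p (leftU p a (b ⊗ₜ 1)) := by
  simp [ofO_eq, ofU_eq, Double.mul_def]

/-- In the double, both $E$ and $Fk$ produce a further term ending in $\otimes k$, coming from the
right action through $S^{-1}$. Because $b\triangleleft E=b\triangleleft Fk$, the two terms agree and
cancel in $\theta$. This is what makes $\theta$ and $\mathcal{O}_q(K\backslash U)$ close under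
reordering. -/
lemma leftU_theta_tmul_one {b : Oq p} (hb : b ∈ OqKU p) : leftU p (theta p) (b ⊗ₜ 1) =
    actL p (theta p) b ⊗ₜ 1 + actL p (Uq.k p) b ⊗ₜ theta p := by
  have hb' : actR p (op (Uq.E p)) b = actR p (op (Uq.k p)) (actR p (op (Uq.F p)) b) := by
    have h : op (theta p) =
        (imagUnit K * p.sqrt⁻¹) • (op (Uq.E p) - op (Uq.k p) * op (Uq.F p)) := rfl
    rw [mem_OqKU, h, map_smul, LinearMap.smul_apply, smul_eq_zero,
      or_iff_right (mul_ne_zero imagUnit_ne_zero (inv_ne_zero p.sqrt_ne_zero))] at hb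
    simpa [sub_eq_zero] using hb
  have h1 : ∀ c, actR p (op (Uq.k p)) (actR p (op (Uq.kInv p)) c) = c := by
    intro c
    rw [← Module.End.mul_apply, ← map_mul, ← MulOpposite.op_mul, Uq.kInv_mul_k]
    simp
  have h2 : ∀ x y : Uq p, ∀ c, actL p x (actR p (op y) c) = actR p (op y) (actL p x c) :=
    fun x y c => LinearMap.congr_fun (actL_comm_actR p x (op y)) c
  simp only [theta_eq, map_smul, map_sub, map_mul, LinearMap.smul_apply, LinearMap.sub_apply,
    Module.End.mul_apply, leftU_E_tmul, leftU_k_tmul, leftU_F_tmul, actR_invAntipode_E,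
    actR_invAntipode_F, actR_invAntipode_k, actR_invAntipode_kInv, hb', h2, h1, actR_kInv_k,
    map_neg, mul_one, Uq.kInv_mul_k, TensorProduct.sub_tmul, TensorProduct.tmul_sub,
    TensorProduct.tmul_smul, ← TensorProduct.smul_tmul', TensorProduct.neg_tmul, ← smul_add]
  congr 1
  abel

lemma thetaG_mul_toUqg (y : OqKU p) : thetaG p * OqKU.toUqg p y =
    OqKU.toUqg p (leftAct p (theta p) y) + OqKU.toUqg p (leftAct p (Uq.k p) y) * thetaG p := by
  apply Subtype.ext
  change Double.ofU p (theta p) * Double.ofO p y = Double.ofO p (actL p (theta p) y) +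
    Double.ofO p (actL p (Uq.k p) y) * Double.ofU p (theta p)
  rw [ofU_mul_ofO, leftU_theta_tmul_one p y.2, map_add, ← ofO_mul_ofU, ← ofO_mul_ofU, map_one,
    mul_one]

/-- The previous relation solved for the opposite order, by substituting $k^{-1}\triangleright y$
for $y$. -/
lemma toUqg_mul_thetaG (y : OqKU p) : OqKU.toUqg p y * thetaG p =
    thetaG p * OqKU.toUqg p (leftAct p (Uq.kInv p) y) -
      OqKU.toUqg p (leftAct p (theta p) (leftAct p (Uq.kInv p) y)) := by
  rw [thetaG_mul_toUqg, leftAct_k_kInv, add_sub_cancel_left]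

/-! ### The filtration of `U_q(𝔤)` -/

lemma thetaG_pow_mul_mem_filt {n s r : ℕ} (h : n + s ≤ r) {y : OqKU p} (hy : y ∈ OqKU.filt p s) :
    thetaG p ^ n * OqKU.toUqg p y ∈ Uqg.filt p r :=
  Submodule.mem_iSup_of_mem n (Submodule.mem_iSup_of_mem (by omega)
    ⟨y, filt_mono p (by omega) hy, rfl⟩)

lemma Uqg.filt_le {r : ℕ} {N : Submodule K (Uqg p)}
    (h : ∀ n s, n + s = r → ∀ y ∈ OqKU.filt p s, thetaG p ^ n * OqKU.toUqg p y ∈ N) :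
    Uqg.filt p r ≤ N := by
  refine iSup₂_le fun n hn => ?_
  rintro _ ⟨y, hy, rfl⟩
  exact h n (r - n) (by omega) y hy

lemma Uqg.filt_mono : Monotone (Uqg.filt p) := fun _ _ hrs =>
  Uqg.filt_le p fun _ _ h _ hy => thetaG_pow_mul_mem_filt p (by omega) hy

lemma thetaG_mul_mem_filt {r : ℕ} {x : Uqg p} (hx : x ∈ Uqg.filt p r) :
    thetaG p * x ∈ Uqg.filt p (r + 1) := by
  refine (Uqg.filt_le p ?_ :
    Uqg.filt p r ≤ (Uqg.filt p (r + 1)).comap (LinearMap.mulLeft K (thetaG p))) hx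
  intro n s h y hy
  change thetaG p * (thetaG p ^ n * OqKU.toUqg p y) ∈ Uqg.filt p (r + 1)
  rw [← mul_assoc, ← pow_succ']
  exact thetaG_pow_mul_mem_filt p (by omega) hy

/-- Commuting $y$ past one $\theta$ replaces it by $k^{-1}\triangleright y$ and
$\theta\triangleright(k^{-1}\triangleright y)$, both of the same degree as $y$. The second term has
lost a $\theta$, so its total degree is one lower. -/
lemma toUqg_mul_mem_filt {s r : ℕ} {y : OqKU p} (hy : y ∈ OqKU.filt p s) {x : Uqg p}
    (hx : x ∈ Uqg.filt p r) : OqKU.toUqg p y * x ∈ Uqg.filt p (s + r) := by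
  have key : ∀ (n s t : ℕ) (y z : OqKU p), y ∈ OqKU.filt p s → z ∈ OqKU.filt p t →
      OqKU.toUqg p y * (thetaG p ^ n * OqKU.toUqg p z) ∈ Uqg.filt p (s + n + t) := by
    intro n
    induction n with
    | zero =>
      intro s t y z hy hz
      rw [pow_zero, one_mul, ← map_mul, add_zero]
      simpa using thetaG_pow_mul_mem_filt p (n := 0) (by omega) (mul_mem_filt p hy hz)
    | succ n ih =>
      intro s t y z hy hz
      have hy' := leftAct_kInv_mem_filt p hy
      rw [pow_succ', mul_assoc, ← mul_assoc, toUqg_mul_thetaG, sub_mul, mul_assoc,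
        show s + (n + 1) + t = s + n + t + 1 by ring]
      exact sub_mem (thetaG_mul_mem_filt p (ih s t _ z hy' hz))
        (Uqg.filt_mono p (by omega) (ih s t _ z (leftAct_theta_mem_filt p hy') hz))
  refine (Uqg.filt_le p ?_ :
    Uqg.filt p r ≤ (Uqg.filt p (s + r)).comap (LinearMap.mulLeft K (OqKU.toUqg p y))) hx
  intro n t h z hz
  have := key n s t y z hy hz
  rwa [add_assoc, h] at this

lemma Uqg.mul_mem_filt {r s : ℕ} {x y : Uqg p} (hx : x ∈ Uqg.filt p r) (hy : y ∈ Uqg.filt p s) :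
    x * y ∈ Uqg.filt p (r + s) := by
  refine (Uqg.filt_le p ?_ :
    Uqg.filt p r ≤ (Uqg.filt p (r + s)).comap (LinearMap.mulRight K y)) hx
  intro n t h z hz
  change thetaG p ^ n * OqKU.toUqg p z * y ∈ Uqg.filt p (r + s)
  rw [mul_assoc]
  have key : ∀ n, thetaG p ^ n * (OqKU.toUqg p z * y) ∈ Uqg.filt p (n + (t + s)) := by
    intro n
    induction n with
    | zero => simpa using toUqg_mul_mem_filt p hz hy
    | succ n ih =>
      rw [pow_succ', mul_assoc, add_right_comm]
      exact thetaG_mul_mem_filt p ih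
  have := key n
  rwa [← add_assoc, h] at this

lemma Uqg.one_mem_filt : 1 ∈ Uqg.filt p 0 := by
  simpa using thetaG_pow_mul_mem_filt p (n := 0) (s := 0) (r := 0) (by omega)
    (QuantumSL2R.one_mem_filt p 0)

lemma Uqg.thetaG_mem_filt : thetaG p ∈ Uqg.filt p 1 := by
  simpa using thetaG_mul_mem_filt p (Uqg.one_mem_filt p)

/-- The union of the subspaces `U_q(𝔤)^{(r)}`. -/
def Uqg.filtUnion : Subalgebra K (Uqg p) where
  carrier := {x | ∃ r, x ∈ Uqg.filt p r}
  add_mem' := by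
    rintro x y ⟨r, hr⟩ ⟨s, hs⟩
    exact ⟨max r s, add_mem (Uqg.filt_mono p (le_max_left r s) hr)
      (Uqg.filt_mono p (le_max_right r s) hs)⟩
  mul_mem' := by
    rintro x y ⟨r, hr⟩ ⟨s, hs⟩
    exact ⟨r + s, Uqg.mul_mem_filt p hr hs⟩
  algebraMap_mem' c := ⟨0, by
    rw [Algebra.algebraMap_eq_smul_one]
    exact Submodule.smul_mem _ _ (Uqg.one_mem_filt p)⟩

/-- The union of the filtration is a subalgebra by multiplicativity, and it contains the generators:
$\theta$ in degree one, and $\mathcal{O}_q(K\backslash U)$ because its own filtration is exhaustive.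
-/
lemma Uqg.exists_mem_filt (x : Uqg p) : ∃ r, x ∈ Uqg.filt p r := by
  have hle : Uqg p ≤ (Uqg.filtUnion p).map (Uqg p).val := by
    refine Algebra.adjoin_le ?_
    rintro _ (⟨t, ht, rfl⟩ | ⟨y, hy, rfl⟩)
    · have h : Uqk p ≤ ((Uqg.filtUnion p).map (Uqg p).val).comap (Double.ofU p) := by
        refine Algebra.adjoin_le ?_
        rintro _ rfl
        exact ⟨thetaG p, ⟨1, Uqg.thetaG_mem_filt p⟩, rfl⟩
      exact h ht
    · obtain ⟨r, hr⟩ := (isAlgebraFiltration_filt p).exhaustive ⟨y, hy⟩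
      exact ⟨OqKU.toUqg p ⟨y, hy⟩,
        ⟨r, by simpa using thetaG_pow_mul_mem_filt p (n := 0) (by omega) hr⟩, rfl⟩
  obtain ⟨y, hy, hyx⟩ := hle x.2
  rwa [← (Subtype.ext hyx : y = x)]

lemma Uqg.isAlgebraFiltration_filt : IsAlgebraFiltration (Uqg.filt p) where
  mono := Uqg.filt_mono p
  one_mem := Uqg.one_mem_filt p
  mul_mem _ _ _ _ := Uqg.mul_mem_filt p
  exhaustive := Uqg.exists_mem_filt p

/-! ### The basis of `U_q(𝔤)` -/

/-- The linear map sending a family `(yₙ)` to `∑ θ^n yₙ`. -/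
def sumThetaPow : (ℕ →₀ OqKU p) →ₗ[K] Uqg p :=
  Finsupp.lsum K fun n => LinearMap.mulLeft K (thetaG p ^ n) ∘ₗ (OqKU.toUqg p).toLinearMap

lemma sumThetaPow_single (n : ℕ) (y : OqKU p) :
    sumThetaPow p (Finsupp.single n y) = thetaG p ^ n * OqKU.toUqg p y := by
  simp [sumThetaPow]

lemma sumThetaPow_surjective : Function.Surjective (sumThetaPow p) := by
  intro x
  obtain ⟨r, hr⟩ := Uqg.exists_mem_filt p x
  refine (Uqg.filt_le p ?_ : Uqg.filt p r ≤ LinearMap.range (sumThetaPow p)) hr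
  intro n s _ y _
  exact ⟨Finsupp.single n y, sumThetaPow_single p n y⟩

/-- The coefficient maps of the powers of `θ` on the double. -/
lemma exists_coordinates : ∃ Φ : ℕ → Double p →ₗ[K] Oq p, ∀ n j b,
    Φ n (Double.ofO p b * Double.ofU p (theta p) ^ j) = if j = n then b else 0 := by
  -- The coordinates with respect to the independent powers of $\theta$ are defined only on their
  -- span; any linear extension to $U_q(\mathfrak{u})$ serves.
  obtain ⟨g, hg⟩ := LinearMap.exists_extend (linearIndependent_theta_pow p).repr
  have hg' : ∀ j, g (theta p ^ j) = Finsupp.single j 1 := by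
    intro j
    have h1 := LinearMap.congr_fun hg
      ⟨theta p ^ j, Submodule.subset_span (Set.mem_range_self j)⟩
    exact h1.trans ((linearIndependent_theta_pow p).repr_eq_single j _ rfl)
  refine ⟨fun n => (TensorProduct.rid K (Oq p)).toLinearMap ∘ₗ
    (Finsupp.lapply n ∘ₗ g).lTensor (Oq p) ∘ₗ (Double.equiv p).symm.toLinearMap, ?_⟩
  intro n j b
  rw [← map_pow, ofO_mul_ofU]
  simp [hg', Finsupp.single_apply]

/-- The span of the elements `b θ^j` of the double with `j < n`. -/
def lowerTheta (n : ℕ) : Submodule K (Double p) :=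
  Submodule.span K {x | ∃ j < n, ∃ b, x = Double.ofO p b * Double.ofU p (theta p) ^ j}

lemma lowerTheta_mono : Monotone (lowerTheta p) := fun _ _ h =>
  Submodule.span_mono fun _ ⟨j, hj, hb⟩ => ⟨j, hj.trans_le h, hb⟩

lemma mem_lowerTheta {j n : ℕ} (h : j < n) (b : Oq p) :
    Double.ofO p b * Double.ofU p (theta p) ^ j ∈ lowerTheta p n :=
  Submodule.subset_span ⟨j, h, b, rfl⟩

lemma lowerTheta_mul_theta {n : ℕ} {x : Double p} (hx : x ∈ lowerTheta p n) :
    x * Double.ofU p (theta p) ∈ lowerTheta p (n + 1) := by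
  refine (Submodule.span_le.2 ?_ : lowerTheta p n ≤
    (lowerTheta p (n + 1)).comap (LinearMap.mulRight K (Double.ofU p (theta p)))) hx
  rintro _ ⟨j, hj, b, rfl⟩
  change Double.ofO p b * Double.ofU p (theta p) ^ j * Double.ofU p (theta p) ∈
    lowerTheta p (n + 1)
  rw [mul_assoc, ← pow_succ]
  exact mem_lowerTheta p (by omega) b

/-- Triangularity: each passage of a $\theta$ to the right of $y$ applies $k$ to $y$, and the
remaining term has one $\theta$ fewer. -/
lemma theta_pow_mul_sub_mem_lowerTheta (n : ℕ) (y : OqKU p) :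
    ((thetaG p ^ n * OqKU.toUqg p y : Uqg p) : Double p) -
      Double.ofO p (leftAct p (Uq.k p ^ n) y) * Double.ofU p (theta p) ^ n ∈ lowerTheta p n := by
  induction n generalizing y with
  | zero =>
    have h : (OqKU.toUqg p y : Double p) = Double.ofO p y := rfl
    simp [h]
  | succ n ih =>
    have h1 := ih (leftAct p (theta p) y)
    have h2 := lowerTheta_mul_theta p (ih (leftAct p (Uq.k p) y))
    -- The leading term of $\theta^n(\theta\triangleright y)$ has exact order $n$, which counts as
    -- lower once the level is $n+1$.
    have h3 := mem_lowerTheta p (Nat.lt_succ_self n)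
      (leftAct p (Uq.k p ^ n) (leftAct p (theta p) y) : OqKU p)
    have h4 := add_mem (add_mem (lowerTheta_mono p (Nat.le_succ n) h1) h2) h3
    rw [pow_succ (thetaG p), mul_assoc, thetaG_mul_toUqg, mul_add, ← mul_assoc,
      pow_succ (Uq.k p), map_mul, Module.End.mul_apply, pow_succ (Double.ofU p (theta p)),
      ← mul_assoc (Double.ofO p _)]
    have h5 : (thetaG p : Double p) = Double.ofU p (theta p) := rfl
    rw [sub_mul] at h4
    convert h4 using 1
    rw [Subalgebra.coe_add, Subalgebra.coe_mul _ (thetaG p ^ n * _) (thetaG p), h5]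
    abel

/-- In a nontrivial relation $\sum\theta^jy_j=0$ with top index $n$, the coefficient of $\theta^n$
on the right is $k^n\triangleright y_n$; applying $k^{-n}$ gives $y_n=0$, a contradiction. -/
lemma sumThetaPow_injective : Function.Injective (sumThetaPow p) := by
  rw [injective_iff_map_eq_zero]
  intro f hf
  by_contra hne
  obtain ⟨Φ, hΦ⟩ := exists_coordinates p
  obtain ⟨n, hn, hmax⟩ := f.support.exists_max_image id (Finsupp.support_nonempty_iff.2 hne)
  have hlow : ∀ j ≤ n, ∀ x ∈ lowerTheta p j, Φ n x = 0 := by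
    intro j hj x hx
    refine (Submodule.span_le.2 ?_ : lowerTheta p j ≤ LinearMap.ker (Φ n)) hx
    rintro _ ⟨i, hi, b, rfl⟩
    exact (hΦ n i b).trans (if_neg (by omega))
  have hterm : ∀ j ≤ n, ∀ y, Φ n ((thetaG p ^ j * OqKU.toUqg p y : Uqg p) : Double p) =
      if j = n then (leftAct p (Uq.k p ^ j) y : Oq p) else 0 := by
    intro j hj y
    rw [← hΦ, ← sub_eq_zero, ← map_sub]
    exact hlow j hj _ (theta_pow_mul_sub_mem_lowerTheta p j y)
  have h := congrArg (fun x : Uqg p => Φ n x) hf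
  have hexp : sumThetaPow p f = ∑ j ∈ f.support, thetaG p ^ j * OqKU.toUqg p (f j) := by
    simp [sumThetaPow, Finsupp.sum]
  simp only [hexp, AddSubmonoidClass.coe_finsetSum, map_sum, ZeroMemClass.coe_zero, map_zero] at h
  rw [Finset.sum_eq_single_of_mem n hn, hterm n le_rfl, if_pos rfl, ZeroMemClass.coe_eq_zero] at h
  · apply Finsupp.mem_support_iff.1 hn
    have h1 := congrArg (leftAct p (Uq.kInv p ^ n)) h
    have h2 : Uq.kInv p ^ n * Uq.k p ^ n = 1 := by
      rw [← (show Commute (Uq.kInv p) (Uq.k p) from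
        (Uq.kInv_mul_k p).trans (Uq.k_mul_kInv p).symm).mul_pow, Uq.kInv_mul_k, one_pow]
    rwa [← Module.End.mul_apply, ← map_mul, h2, map_one, map_zero, Module.End.one_apply] at h1
  · intro j hj hjn
    rw [hterm j (hmax j hj), if_neg hjn]

/-- The basis of `U_q(𝔤)` consisting of the `θ^{m₁} W^{(n)} Z^{m₂}`. -/
def basisThetaWZ : Module.Basis (ℕ × ℤ × ℕ) K (Uqg p) :=
  ((Finsupp.basis fun _ : ℕ => basisWZ p).map (LinearEquiv.ofBijective (sumThetaPow p)
    ⟨sumThetaPow_injective p, sumThetaPow_surjective p⟩)).reindex (Equiv.sigmaEquivProd _ _)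

lemma basisThetaWZ_apply (m₁ : ℕ) (n : ℤ) (m₂ : ℕ) : basisThetaWZ p (m₁, n, m₂) =
    thetaG p ^ m₁ * OqKU.toUqg p (W p n) * OqKU.toUqg p (Z p) ^ m₂ := by
  have h : basisThetaWZ p (m₁, n, m₂) =
      sumThetaPow p (Finsupp.single m₁ (basisWZ p (n, m₂))) := by
    simp only [basisThetaWZ, Module.Basis.reindex_apply, Module.Basis.map_apply, Finsupp.coe_basis]
    rfl
  rw [h, sumThetaPow_single, basisWZ_apply, map_mul, map_pow, mul_assoc]

end

end QuantumSL2R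

end

theorem mainTheorem8 {K : Type*} [Field K] [StarRing K] [Algebra ℂ K] [StarModule ℂ K]
    (p : QuantumSL2R.Param K) :
    (∃ B : Module.Basis (ℤ × ℕ) K (QuantumSL2R.OqKU p),
      ∀ (n : ℤ) (m : ℕ), B (n, m) = QuantumSL2R.W p n * QuantumSL2R.Z p ^ m) ∧
    QuantumSL2R.IsAlgebraFiltration (QuantumSL2R.OqKU.filt p) ∧
    (∃ B : Module.Basis (ℕ × ℤ × ℕ) K (QuantumSL2R.Uqg p),
      ∀ (m₁ : ℕ) (n : ℤ) (m₂ : ℕ), B (m₁, n, m₂) =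
        QuantumSL2R.thetaG p ^ m₁ * QuantumSL2R.OqKU.toUqg p (QuantumSL2R.W p n) *
          QuantumSL2R.OqKU.toUqg p (QuantumSL2R.Z p) ^ m₂) ∧
    QuantumSL2R.IsAlgebraFiltration (QuantumSL2R.Uqg.filt p) :=
  ⟨⟨QuantumSL2R.basisWZ p, QuantumSL2R.basisWZ_apply p⟩,
    QuantumSL2R.isAlgebraFiltration_filt p,
    ⟨QuantumSL2R.basisThetaWZ p, QuantumSL2R.basisThetaWZ_apply p⟩,
    QuantumSL2R.Uqg.isAlgebraFiltration_filt p⟩
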